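/- All graphs are finite and simple. A graph is diamond-free if it has no induced subgraph isomorphic to $K_4-e$. A clique-transversal of a graph $G$ is a set of vertices meeting every (inclusionwise) maximal clique of $G$, and a clique-independent set is a collection of pairwise vertex-disjoint maximal cliques of $G$; $\tau_c(G)$ and $\alpha_c(G)$ denote the minimum size of a clique-transversal and the maximum size of a clique-independent set (both are $0$ for the graph without vertices). $G$ is clique-perfect if $\tau_c(G')=\alpha_c(G')$ for every induced subgraph $G'$ of $G$. An odd hole is a cycle $C_n$ with $n\ge 5$ odd; it occurs in $G$ as an induced subgraph. A multisun is a diamond-free graph $G$ of odd order whose maximal cliques of size $2$ form a Hamiltonian cycle of $G$, called its rim; the remaining maximal cliques are called the inscribed cliques. (No inscribed clique contains two consecutive vertices of the rim.) A sub-multisun of $G$ is a graph obtained from $G$ by removing the edges of some, but not all, of its inscribed cliques. For inscribed cliques $A,B$ (possibly equal), an $AB$-path is a subpath of the rim with distinct endpoints, one in $A$ and the other in $B$, whose inner vertices lie in no inscribed clique; an $A$-path is an $AA$-path, and an $A\xi$-path is an $AB$-path, for some inscribed clique $B\ni\xi$ (possibly $B=A$), whose endpoint in $B$ is the vertex $\xi$.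 A multisun satisfies the N-conditions if 1. for each inscribed clique $A$, every $A$-path has an even number, at least $4$, of vertices; 2. each inscribed clique has odd size; 3. there is a vertex $\xi$ such that any two distinct inscribed cliques intersect exactly in $\{\xi\}$; 4. for this $\xi$ and every inscribed clique $A$, every $A\xi$-path has an even number of vertices; 5. for any two distinct inscribed cliques $A,B$, every $AB$-path whose endpoint in $A$ lies in no inscribed clique other than $A$ and whose endpoint in $B$ lies in no inscribed clique other than $B$ has an odd number of vertices. A sunoid is a multisun with at least one inscribed clique that satisfies the N-conditions and all of whose sub-multisuns satisfy the N-conditions. **Theorem.** Let $G$ be a diamond-free graph. Then $G$ is clique-perfect if and only if no induced subgraph of $G$ is an odd hole or a sunoid. Moreover, these forbidden induced subgraphs are minimal: if $G$ itself is an odd hole or a sunoid, then $G$ is not clique-perfect, but every proper induced subgraph of $G$ is clique-perfect. -/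

import Mathlib

namespace SimpleGraph

variable {V : Type*}

/-- The diamond `K₄ - e`. -/
def diamond : SimpleGraph (Fin 4) := (⊤ : SimpleGraph (Fin 4)).deleteEdges {s(0, 1)}

/-- No induced subgraph is a diamond. -/
def IsDiamondFree (G : SimpleGraph V) : Prop := ¬ diamond.IsIndContained G

/-- Inclusionwise maximal cliques. Nonemptiness only matters for the graph without vertices,
which thereby has no maximal clique. -/
def IsMaxClique (G : SimpleGraph V) (K : Finset V) : Prop :=
  K.Nonempty ∧ Maximal (fun s : Finset V => G.IsClique (s : Set V)) K

/-- A set of vertices that meets all maximal cliques. -/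
def IsCliqueTransversal (G : SimpleGraph V) (T : Finset V) : Prop :=
  ∀ K : Finset V, G.IsMaxClique K → ∃ v ∈ T, v ∈ K

/-- A collection of pairwise vertex-disjoint maximal cliques. -/
def IsCliqueIndependent (G : SimpleGraph V) (F : Finset (Finset V)) : Prop :=
  (∀ K ∈ F, G.IsMaxClique K) ∧ (F : Set (Finset V)).PairwiseDisjoint id

/-- `τ_c(G)`, the minimum size of a clique-transversal. -/
noncomputable def cliqueTransversalNum (G : SimpleGraph V) : ℕ :=
  sInf {k | ∃ T : Finset V, G.IsCliqueTransversal T ∧ T.card = k}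

/-- `α_c(G)`, the maximum size of a clique-independent set. -/
noncomputable def cliqueIndependenceNum (G : SimpleGraph V) : ℕ :=
  sSup {k | ∃ F : Finset (Finset V), G.IsCliqueIndependent F ∧ F.card = k}

/-- On finite graphs the minimum is attained. -/
theorem cliqueTransversalNum_isLeast [Finite V] (G : SimpleGraph V) :
    IsLeast {k | ∃ T : Finset V, G.IsCliqueTransversal T ∧ T.card = k}
      G.cliqueTransversalNum := by
  have := Fintype.ofFinite V
  have hne : {k | ∃ T : Finset V, G.IsCliqueTransversal T ∧ T.card = k}.Nonempty :=
    ⟨_, Finset.univ, fun K hK => hK.1.imp fun v hv => ⟨Finset.mem_univ v, hv⟩, rfl⟩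
  exact ⟨Nat.sInf_mem hne, fun k hk => Nat.sInf_le hk⟩

/-- On finite graphs the maximum is attained. -/
theorem cliqueIndependenceNum_isGreatest [Finite V] (G : SimpleGraph V) :
    IsGreatest {k | ∃ F : Finset (Finset V), G.IsCliqueIndependent F ∧ F.card = k}
      G.cliqueIndependenceNum := by
  have := Fintype.ofFinite V
  have hne : {k | ∃ F : Finset (Finset V), G.IsCliqueIndependent F ∧ F.card = k}.Nonempty :=
    ⟨0, ∅, ⟨by simp, by simp⟩, rfl⟩
  have hb : BddAbove {k | ∃ F : Finset (Finset V), G.IsCliqueIndependent F ∧ F.card = k} := by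
    refine ⟨Fintype.card (Finset V), ?_⟩
    rintro k ⟨F, -, rfl⟩
    exact Finset.card_le_univ F
  exact ⟨Nat.sSup_mem hne hb, fun k hk => le_csSup hb hk⟩

/-- `τ_c(G') = α_c(G')` for every induced subgraph `G'` of `G`. -/
def IsCliquePerfect (G : SimpleGraph V) : Prop :=
  ∀ s : Set V, (G.induce s).cliqueTransversalNum = (G.induce s).cliqueIndependenceNum

/-- Not clique-perfect, although every proper induced subgraph is. -/
def IsMinimallyCliqueImperfect (G : SimpleGraph V) : Prop :=
  ¬ G.IsCliquePerfect ∧ ∀ s : Set V, s ≠ Set.univ → (G.induce s).IsCliquePerfect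

/-- The graph is a chordless cycle of odd length at least five. -/
def IsOddHole (G : SimpleGraph V) : Prop :=
  ∃ n : ℕ, 5 ≤ n ∧ Odd n ∧ Nonempty (cycleGraph n ≃g G)

/-- The spanning subgraph whose edges are the maximal cliques of size two. -/
def rim (G : SimpleGraph V) : SimpleGraph V where
  Adj u v := u ≠ v ∧ ∃ K : Finset V, G.IsMaxClique K ∧ (K : Set V) = {u, v}
  symm := ⟨fun u v h => ⟨h.1.symm, by rw [Set.pair_comm]; exact h.2⟩⟩
  loopless := ⟨fun _ h => h.1 rfl⟩

/-- The maximal cliques other than those of size two. -/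
def inscribedCliques (G : SimpleGraph V) : Set (Finset V) :=
  {K | G.IsMaxClique K ∧ K.card ≠ 2}

/-- No inscribed clique contains two consecutive vertices of the rim. -/
theorem not_rim_adj_of_mem_inscribedCliques (G : SimpleGraph V) {K : Finset V}
    (hK : K ∈ G.inscribedCliques) {u v : V} (hu : u ∈ K) (hv : v ∈ K) : ¬ G.rim.Adj u v := by
  rintro ⟨huv, L, hL, hLuv⟩
  have hLK : L ≤ K := by
    intro w hw
    have hw' : w ∈ ({u, v} : Set V) := hLuv ▸ (Finset.mem_coe.2 hw)
    rcases hw' with rfl | rfl <;> assumption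
  have hKL : K ≤ L := hL.2.2 hK.1.2.1 hLK
  have h : L = K := le_antisymm hLK hKL
  subst h
  apply hK.2
  rw [← Set.ncard_coe_finset, hLuv, Set.ncard_pair huv]

/-- A diamond-free graph of odd order whose maximal cliques of size two form a Hamiltonian cycle.
That the other maximal cliques have no two consecutive vertices on this cycle is automatic
(`not_rim_adj_of_mem_inscribedCliques`). -/
def IsMultisun (G : SimpleGraph V) : Prop :=
  G.IsDiamondFree ∧ 3 ≤ Nat.card V ∧ Odd (Nat.card V) ∧
    Nonempty (cycleGraph (Nat.card V) ≃g G.rim)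

/-- The graph obtained by removing the edges of the cliques in `R`. -/
def removeCliques (G : SimpleGraph V) (R : Set (Finset V)) : SimpleGraph V :=
  G.deleteEdges {e | ∃ K ∈ R, ∀ v ∈ e, v ∈ K}

/-- `H` arises from `G` by removing the edges of some, but not all, of the inscribed cliques. -/
def IsSubMultisun (H G : SimpleGraph V) : Prop :=
  ∃ R : Set (Finset V), R ⊂ G.inscribedCliques ∧ H = G.removeCliques R

/-- `p` is an `AB`-path: a path on the rim with distinct endpoints, the first in `A` and the last
in `B`, all of whose inner vertices lie in no inscribed clique. -/
def IsCliquePath (G : SimpleGraph V) (A B : Finset V) {u v : V} (p : G.rim.Walk u v) : Prop :=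
  p.IsPath ∧ u ≠ v ∧ u ∈ A ∧ v ∈ B ∧
    ∀ w ∈ p.support, w ≠ u → w ≠ v → ∀ K ∈ G.inscribedCliques, w ∉ K

/-- The N-conditions. In the last one, the endpoint in `A` belongs to no inscribed clique but `A`
and the endpoint in `B` to none but `B`, so that both differ from `ξ`. -/
def NConditions (G : SimpleGraph V) : Prop :=
  (∀ A ∈ G.inscribedCliques, ∀ (u v : V) (p : G.rim.Walk u v), G.IsCliquePath A A p →
    Even p.support.length ∧ 4 ≤ p.support.length) ∧
  (∀ A ∈ G.inscribedCliques, Odd A.card) ∧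
  (∃ ξ : V,
    (∀ A ∈ G.inscribedCliques, ∀ B ∈ G.inscribedCliques, A ≠ B → (A : Set V) ∩ B = {ξ}) ∧
    (∀ A ∈ G.inscribedCliques, ∀ B ∈ G.inscribedCliques, ∀ (u : V) (p : G.rim.Walk u ξ),
      G.IsCliquePath A B p → Even p.support.length)) ∧
  (∀ A ∈ G.inscribedCliques, ∀ B ∈ G.inscribedCliques, A ≠ B →
    ∀ (u v : V) (p : G.rim.Walk u v), G.IsCliquePath A B p →
      (∀ K ∈ G.inscribedCliques, u ∈ K → K = A) →
      (∀ K ∈ G.inscribedCliques, v ∈ K → K = B) → Odd p.support.length)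

/-- A multisun that satisfies the N-conditions, as does each of its sub-multisuns. It has an
inscribed clique: without one, a multisun is just its rim, an odd hole. -/
def IsSunoid (G : SimpleGraph V) : Prop :=
  G.IsMultisun ∧ G.inscribedCliques.Nonempty ∧ G.NConditions ∧
    ∀ H : SimpleGraph V, IsSubMultisun H G → H.NConditions

end SimpleGraph

/-! ### Odd cycles and two-colourings -/

namespace SimpleGraph

variable {V : Type*}

/-! Everything passes through the bipartiteness of rims. The rim of the subgraph induced by `S`
consists of its maximal cliques of size two, and `isCliquePerfect_iff` says that a diamond-free
graph is clique-perfect exactly when all these rims are bipartite.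

If all rims are bipartite, the incidence relation between maximal cliques and vertices is balanced:
on the vertex set `S` of an odd cycle submatrix, each clique of the cycle meets `S` in just two
vertices, and in a diamond-free graph these form a rim edge of `S`, so the rim of `S` has an odd
closed walk. Balanced hypergraphs have the König property
(`IsBalancedIncidence.exists_transversal_matching`), which is `τ_c = α_c`. Conversely, an
inclusionwise minimal `S` with non-bipartite rim is spanned by an induced odd cycle of that rim. If
it has `n` vertices, a transversal has more than `n / 2` vertices, whereas fewer than `n / 2`
maximal cliques can be disjoint.

It remains to show that the diamond-free graphs with minimal odd rim are the odd holes and the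
sunoids. The N-conditions of all sub-multisuns are condensed into `HasPathParity`: parities of rim
paths relative to one or two inscribed cliques, and a common vertex `ξ`.

From minimality to parity: a set that misses part of an inscribed clique has a 2-colourable rim, and
suitable unions of rim paths yield the parities. That two inscribed cliques meet is a parity count
around the rim (`IsInducedOddCycle.not_disjoint_of_transitions`); a common vertex then follows from
diamond-freeness (`IsMinimalOddRim.exists_common`).

From parity to minimality: take an odd cycle spanning a minimal odd rim inside the graph. If it uses
only rim edges of the whole graph, it is the entire rim. Otherwise its chords, which lie in
inscribed cliques, are separated by odd distances, so there are at least three. Two cliques through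
`ξ` are nested along the rim (`HasPathParity.count_parity`), and this excludes the rim paths that
join consecutive chords (`IsCliqueCycle.not_isChord`). -/

/-- `f` runs periodically, with odd period `n`, through an induced cycle of `R`. -/
structure IsInducedOddCycle (R : SimpleGraph V) (n : ℕ) (f : ℕ → V) : Prop where
  odd : Odd n
  three_le : 3 ≤ n
  periodic : ∀ i, f (i + n) = f i
  adj : ∀ i, R.Adj (f i) (f (i + 1))
  inj : ∀ i j, f i = f j → i ≡ j [MOD n]
  adj_only : ∀ i j, R.Adj (f i) (f j) → j ≡ i + 1 [MOD n] ∨ i ≡ j + 1 [MOD n]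

/-- A graph that admits a proper 2-colouring. -/
def IsTwoColorable (R : SimpleGraph V) : Prop := ∃ c : V → Bool, ∀ u v, R.Adj u v → c u ≠ c v

theorem alternating_eq_iff {b : ℕ → Bool} {k : ℕ} (h : ∀ i < k, b i ≠ b (i + 1)) :
    b k = b 0 ↔ Even k := by
  induction k with
  | zero => simp
  | succ k ih =>
    have h1 := h k (by omega)
    have h2 := ih fun i hi => h i (by omega)
    rw [Nat.even_add_one, ← h2]
    cases hb : b k <;> cases hb' : b (k + 1) <;> cases b 0 <;> simp_all

/-- A closed walk of odd length `n`. -/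
def IsOddClosedWalk (R : SimpleGraph V) (n : ℕ) (f : ℕ → V) : Prop :=
  Odd n ∧ f n = f 0 ∧ ∀ i < n, R.Adj (f i) (f (i + 1))

/-- If no closed walk is odd, the parity of a walk from a chosen representative of the component is
well defined and gives a proper colouring. -/
theorem exists_oddClosedWalk {R : SimpleGraph V} (h : ¬ R.IsTwoColorable) :
    ∃ n f, R.IsOddClosedWalk n f := by
  classical
  by_contra hno
  have hw : ∀ (u : V) (w : R.Walk u u), ¬ Odd w.length := by
    intro u w hodd
    exact hno ⟨w.length, w.getVert, hodd, by simp, fun i hi => w.adj_getVert_succ hi⟩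
  apply h
  let r : V → V := fun v => (R.connectedComponentMk v).out
  have hr : ∀ v, R.Reachable (r v) v := fun v =>
    ConnectedComponent.exact (Quot.out_eq (R.connectedComponentMk v))
  refine ⟨fun v => decide (∃ w : R.Walk (r v) v, Even w.length), fun u v huv heq => ?_⟩
  have hruv : r u = r v := by
    simp only [r]
    rw [ConnectedComponent.sound huv.reachable]
  simp only [decide_eq_decide] at heq
  have key : ∀ (a b : V) (w₁ : R.Walk a u) (w₂ : R.Walk b v), a = b →
      ¬ Odd (w₁.length + 1 + w₂.length) := by
    rintro a b w₁ w₂ rfl hodd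
    apply hw a ((w₁.concat huv).append w₂.reverse)
    simpa using hodd
  by_cases hu : ∃ w : R.Walk (r u) u, Even w.length
  · obtain ⟨w₂, hw₂⟩ := heq.1 hu
    obtain ⟨w₁, hw₁⟩ := hu
    refine key _ _ w₁ w₂ hruv ?_
    grind
  · obtain ⟨w₁⟩ := hr u
    obtain ⟨w₂⟩ := hr v
    have h1 : ¬ Even w₁.length := fun h => hu ⟨w₁, h⟩
    have h2 : ¬ Even w₂.length := fun h => hu (heq.2 ⟨w₂, h⟩)
    refine key _ _ w₁ w₂ hruv ?_
    grind

/-- A shortest odd closed walk is an induced cycle: a repeated vertex or a chord would split off a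
shorter odd closed walk. -/
theorem exists_isInducedOddCycle {R : SimpleGraph V} (h : ¬ R.IsTwoColorable) :
    ∃ n f, R.IsInducedOddCycle n f := by
  classical
  have hex : ∃ n, ∃ f, R.IsOddClosedWalk n f := exists_oddClosedWalk h
  obtain ⟨f, hodd, hclosed, hadj⟩ := Nat.find_spec hex
  set n := Nat.find hex with hn
  have hmin : ∀ m g, R.IsOddClosedWalk m g → n ≤ m := fun m g hg => Nat.find_min' hex ⟨g, hg⟩
  have hn3 : 3 ≤ n := by
    by_contra hlt
    have h1 : n = 1 := by
      obtain ⟨k, hk⟩ := hodd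
      omega
    have := hadj 0 (by omega)
    rw [zero_add, ← h1, hclosed] at this
    exact this.ne rfl
  have hinj : ∀ i j, i < j → j < n → f i ≠ f j := by
    intro i j hij hj he
    -- The repetition cuts the walk into closed walks of lengths `j - i` and `n - (j - i)`, one of
    -- which is odd.
    rcases Nat.even_or_odd (j - i) with hd | hd
    · have := hmin (n - (j - i)) (fun k => if k ≤ i then f k else f (k + (j - i))) ⟨?_, ?_, ?_⟩
      · omega
      · rw [Nat.odd_sub (by omega)]
        exact ⟨fun _ => hd, fun _ => hodd⟩
      · have h1 : ¬ n - (j - i) ≤ i := by omega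
        have h2 : n - (j - i) + (j - i) = n := by omega
        simp [h1, h2, hclosed]
      · intro k hk
        dsimp only
        rcases lt_trichotomy k i with hki | hki | hki
        · rw [if_pos (by omega), if_pos (by omega)]
          exact hadj k (by omega)
        · subst hki
          rw [if_pos (by omega), if_neg (by omega), he]
          have h3 : k + 1 + (j - k) = j + 1 := by omega
          rw [h3]
          exact hadj j hj
        · rw [if_neg (by omega), if_neg (by omega)]
          have h3 : k + 1 + (j - i) = k + (j - i) + 1 := by omega
          rw [h3]
          exact hadj _ (by omega)
    · have := hmin (j - i) (fun k => f (i + k)) ⟨hd, ?_, ?_⟩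
      · omega
      · have h3 : i + (j - i) = j := by omega
        simp [h3, he]
      · intro k hk
        exact hadj (i + k) (by omega)
  have hchord : ∀ i j, i < j → j < n → R.Adj (f i) (f j) → j = i + 1 ∨ (i = 0 ∧ j + 1 = n) := by
    intro i j hij hj ha
    by_contra hcon
    -- The chord closes both arcs. The resulting lengths `j - i + 1` and `n - (j - i) + 1` have odd
    -- sum `n + 2`.
    rcases Nat.even_or_odd (j - i) with hd | hd
    · have := hmin (j - i + 1) (fun k => if k ≤ j - i then f (i + k) else f i) ⟨hd.add_one, ?_, ?_⟩
      · omega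
      · simp
      · intro k hk
        dsimp only
        rcases Nat.lt_or_ge k (j - i) with hkj | hkj
        · rw [if_pos (by omega), if_pos (by omega)]
          exact hadj (i + k) (by omega)
        · have h3 : k = j - i := by omega
          have h4 : i + k = j := by omega
          rw [if_pos (by omega), if_neg (by omega), h4]
          exact ha.symm
    · have := hmin (n - (j - i) + 1)
        (fun k => if k ≤ i then f k else f (k + (j - i) - 1)) ⟨?_, ?_, ?_⟩
      · omega
      · grind
      · have h1 : ¬ n - (j - i) + 1 ≤ i := by omega
        have h2 : n - (j - i) + 1 + (j - i) - 1 = n := by omega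
        simp [h1, h2, hclosed]
      · intro k hk
        dsimp only
        rcases lt_trichotomy k i with hki | hki | hki
        · rw [if_pos (by omega), if_pos (by omega)]
          exact hadj k (by omega)
        · subst hki
          rw [if_pos (by omega), if_neg (by omega)]
          have h3 : k + 1 + (j - k) - 1 = j := by omega
          rw [h3]
          exact ha
        · rw [if_neg (by omega), if_neg (by omega)]
          have h3 : k + 1 + (j - i) - 1 = k + (j - i) - 1 + 1 := by omega
          rw [h3]
          exact hadj _ (by omega)
  have hmod : ∀ i, i % n < n := fun i => Nat.mod_lt _ (by omega)
  have hsucc : ∀ i, f ((i + 1) % n) = f (i % n + 1) := by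
    intro i
    rw [Nat.add_mod_eq_ite, Nat.mod_eq_of_lt (show 1 < n by omega)]
    have := hmod i
    split_ifs with hc
    · have : i % n + 1 = n := by omega
      rw [this, Nat.sub_self, hclosed]
    · rfl
  refine ⟨n, fun i => f (i % n), hodd, hn3, fun i => by simp, fun i => ?_, fun i j hij => ?_,
    fun i j hij => ?_⟩
  · rw [hsucc]
    exact hadj _ (hmod i)
  · by_contra hne
    rcases lt_or_gt_of_ne (show i % n ≠ j % n from hne) with hlt | hlt
    · exact hinj _ _ hlt (hmod j) hij
    · exact hinj _ _ hlt (hmod i) hij.symm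
  · have hne : i % n ≠ j % n := fun hc => hij.ne (by simp [hc])
    have key : ∀ i j, i % n < j % n → R.Adj (f (i % n)) (f (j % n)) →
        j ≡ i + 1 [MOD n] ∨ i ≡ j + 1 [MOD n] := by
      intro i j hlt ha
      have e : ∀ a b : ℕ, a % n = b % n + 1 → a ≡ b + 1 [MOD n] := by
        intro a b hab
        have h1 : a % n ≡ b % n + 1 [MOD n] := by rw [hab]
        exact (Nat.mod_modEq a n).symm.trans (h1.trans ((Nat.mod_modEq b n).add_right 1))
      rcases hchord _ _ hlt (hmod j) ha with hc | ⟨h0, h1⟩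
      · exact Or.inl (e _ _ hc)
      · right
        have h2 : j % n + 1 ≡ i % n [MOD n] := by
          rw [h1, h0]
          simp [Nat.ModEq]
        exact ((Nat.mod_modEq i n).symm.trans h2.symm).trans ((Nat.mod_modEq j n).add_right 1)
    rcases lt_or_gt_of_ne hne with hlt | hlt
    · exact key i j hlt hij
    · exact (key j i hlt hij.symm).symm

namespace IsInducedOddCycle

variable {R : SimpleGraph V} {n : ℕ} {f : ℕ → V}

theorem pos (h : R.IsInducedOddCycle n f) : 0 < n := by
  have := h.three_le
  omega

theorem mod (h : R.IsInducedOddCycle n f) (i : ℕ) : f (i % n) = f i := by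
  have : ∀ k, f (i % n + n * k) = f (i % n) := by
    intro k
    induction k with
    | zero => simp
    | succ k ih => rw [Nat.mul_succ, ← add_assoc, h.periodic, ih]
  rw [← this (i / n), Nat.mod_add_div]

theorem eq_iff (h : R.IsInducedOddCycle n f) {i j : ℕ} : f i = f j ↔ i ≡ j [MOD n] :=
  ⟨h.inj i j, fun hij => by rw [← h.mod i, ← h.mod j, hij]⟩

/-- Within a window of length less than the period the enumeration is injective. -/
theorem inj_of_lt (h : R.IsInducedOddCycle n f) {i j : ℕ} (hij : f i = f j) (h1 : i < j + n)
    (h2 : j < i + n) : i = j := by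
  have := h.inj i j hij
  rcases le_total i j with hle | hle
  · have h3 := (Nat.modEq_iff_dvd' hle).1 this
    have := Nat.eq_zero_of_dvd_of_lt h3 (by omega)
    omega
  · have h3 := (Nat.modEq_iff_dvd' hle).1 this.symm
    have := Nat.eq_zero_of_dvd_of_lt h3 (by omega)
    omega

theorem shift (h : R.IsInducedOddCycle n f) (k : ℕ) :
    R.IsInducedOddCycle n (fun i => f (k + i)) where
  odd := h.odd
  three_le := h.three_le
  periodic i := by rw [← add_assoc, h.periodic]
  adj i := h.adj (k + i)
  inj i j hij := Nat.ModEq.add_left_cancel' k (h.inj _ _ hij)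
  adj_only i j hij := by
    rcases h.adj_only _ _ hij with h | h
    · exact Or.inl (Nat.ModEq.add_left_cancel' k h)
    · exact Or.inr (Nat.ModEq.add_left_cancel' k h)

theorem not_isTwoColorable (h : R.IsInducedOddCycle n f) : ¬ R.IsTwoColorable := by
  rintro ⟨c, hc⟩
  have h1 := (alternating_eq_iff (b := fun i => c (f i)) (k := n) fun i _ => hc _ _ (h.adj i)).1
  have h2 := h.periodic 0
  rw [zero_add] at h2
  exact (Nat.not_even_iff_odd.2 h.odd) (h1 (congrArg c h2))

end IsInducedOddCycle

end SimpleGraph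

namespace SimpleGraph

variable {V : Type*}

/-! ### Rims of induced subgraphs and maximal cliques -/

/-- The rim of the subgraph induced by `S`, as a graph on all vertices: edges inside `S` without
a common neighbour in `S`. -/
def rimOn (G : SimpleGraph V) (S : Set V) : SimpleGraph V where
  Adj u v := u ∈ S ∧ v ∈ S ∧ G.Adj u v ∧ ∀ w ∈ S, ¬ (G.Adj w u ∧ G.Adj w v)
  symm := ⟨fun _ _ h => ⟨h.2.1, h.1, h.2.2.1.symm, fun w hw hc => h.2.2.2 w hw hc.symm⟩⟩
  loopless := ⟨fun _ h => h.2.2.1.ne rfl⟩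

theorem rim_adj_iff {G : SimpleGraph V} {u v : V} :
    G.rim.Adj u v ↔ G.Adj u v ∧ ∀ w, ¬ (G.Adj w u ∧ G.Adj w v) := by
  classical
  constructor
  · rintro ⟨huv, K, hK, hKuv⟩
    have hu : u ∈ K := by rw [← Finset.mem_coe, hKuv]; simp
    have hv : v ∈ K := by rw [← Finset.mem_coe, hKuv]; simp
    refine ⟨hK.2.1 hu hv huv, fun w ⟨hwu, hwv⟩ => ?_⟩
    have hcl : G.IsClique ((insert w K : Finset V) : Set V) := by
      rw [Finset.coe_insert, isClique_insert]
      refine ⟨hK.2.1, fun x hx _ => ?_⟩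
      rw [hKuv] at hx
      rcases hx with rfl | rfl <;> assumption
    have hw : w ∈ K := hK.2.2 hcl (Finset.subset_insert w K) (Finset.mem_insert_self w K)
    rw [← Finset.mem_coe, hKuv] at hw
    rcases hw with rfl | rfl
    · exact hwu.ne rfl
    · exact hwv.ne rfl
  · rintro ⟨huv, hno⟩
    refine ⟨huv.ne, {u, v}, ⟨by simp, ?_, ?_⟩, by simp⟩
    · simp [huv]
    · intro L hL hle w hw
      by_contra hnot
      simp only [Finset.mem_insert, Finset.mem_singleton, not_or] at hnot
      exact hno w ⟨hL hw (hle (by simp)) hnot.1, hL hw (hle (by simp)) hnot.2⟩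

theorem rimOn_univ (G : SimpleGraph V) : G.rimOn Set.univ = G.rim := by
  ext u v
  rw [rim_adj_iff]
  simp [rimOn]

/-- Deleting vertices only removes common neighbours, so rim edges survive, although new ones may
appear. -/
theorem rimOn_mono {G : SimpleGraph V} {S T : Set V} (hTS : T ⊆ S) {u v : V} (hu : u ∈ T)
    (hv : v ∈ T) (h : (G.rimOn S).Adj u v) : (G.rimOn T).Adj u v :=
  ⟨hu, hv, h.2.2.1, fun w hw => h.2.2.2 w (hTS hw)⟩

theorem rimOn_of_rim {G : SimpleGraph V} {T : Set V} {u v : V} (hu : u ∈ T)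
    (hv : v ∈ T) (h : G.rim.Adj u v) : (G.rimOn T).Adj u v :=
  rimOn_mono (Set.subset_univ T) hu hv (by rwa [rimOn_univ])

theorem rimOn_induce {G : SimpleGraph V} {s : Set V} {T : Set s} {u v : s} :
    ((G.induce s).rimOn T).Adj u v ↔ (G.rimOn (Subtype.val '' T)).Adj u v := by
  simp [rimOn]

/-- The rim of the subgraph induced by `S` is bipartite. -/
def IsRimBipartite (G : SimpleGraph V) (S : Set V) : Prop := (G.rimOn S).IsTwoColorable

theorem isRimBipartite_induce {G : SimpleGraph V} {s : Set V} {T : Set s} :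
    (G.induce s).IsRimBipartite T ↔ G.IsRimBipartite (Subtype.val '' T) := by
  classical
  constructor
  · rintro ⟨c, hc⟩
    refine ⟨fun v => if h : v ∈ s then c ⟨v, h⟩ else true, fun u v huv => ?_⟩
    have hu : u ∈ s := by obtain ⟨x, -, rfl⟩ := huv.1; exact x.2
    have hv : v ∈ s := by obtain ⟨x, -, rfl⟩ := huv.2.1; exact x.2
    simpa [hu, hv] using hc ⟨u, hu⟩ ⟨v, hv⟩ (rimOn_induce.2 huv)
  · rintro ⟨c, hc⟩
    exact ⟨fun v => c v, fun u v huv => hc u v (rimOn_induce.1 huv)⟩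

/-- The rim is not bipartite, whereas that of every proper induced subgraph is. -/
def IsMinimalOddRim (G : SimpleGraph V) (S : Set V) : Prop :=
  ¬ G.IsRimBipartite S ∧ ∀ T ⊂ S, G.IsRimBipartite T

theorem exists_isMinimalOddRim [Finite V] {G : SimpleGraph V} {S : Set V}
    (h : ¬ G.IsRimBipartite S) : ∃ T ⊆ S, G.IsMinimalOddRim T := by
  obtain ⟨T, hTS, hT⟩ := (Set.toFinite {T : Set V | ¬ G.IsRimBipartite T}).exists_le_minimal h
  refine ⟨T, hTS, hT.1, fun U hU => ?_⟩
  by_contra hcon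
  exact hU.2 (hT.2 hcon hU.1)

theorem isMinimalOddRim_induce {G : SimpleGraph V} {s : Set V} :
    (G.induce s).IsMinimalOddRim Set.univ ↔ G.IsMinimalOddRim s := by
  unfold IsMinimalOddRim
  rw [isRimBipartite_induce]
  simp only [Set.image_univ, Subtype.range_coe_subtype, Set.ofPred_mem_eq]
  refine and_congr_right fun _ => ⟨fun h T hT => ?_, fun h T hT => ?_⟩
  · have h1 := h (Subtype.val ⁻¹' T) ⟨Set.subset_univ _, fun hc => hT.2 fun x hx => ?_⟩
    · rw [isRimBipartite_induce, Subtype.image_preimage_coe, Set.inter_eq_right.2 hT.1] at h1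
      exact h1
    · exact @hc ⟨x, hx⟩ trivial
  · rw [isRimBipartite_induce]
    refine h _ ⟨by rintro _ ⟨x, -, rfl⟩; exact x.2, fun hc => hT.2 fun x _ => ?_⟩
    obtain ⟨y, hy, hyx⟩ := hc x.2
    rwa [← Subtype.ext hyx]

/-- The edges of an odd cycle in the rim remain rim edges on the vertex set of the cycle, so by
minimality this set is all of `S`. -/
theorem IsMinimalOddRim.exists_cycle {G : SimpleGraph V} {S : Set V} (h : G.IsMinimalOddRim S) :
    ∃ n f, (G.rimOn S).IsInducedOddCycle n f ∧ Set.range f = S := by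
  obtain ⟨n, f, hf⟩ := exists_isInducedOddCycle h.1
  refine ⟨n, f, hf, ?_⟩
  have hsub : Set.range f ⊆ S := by
    rintro _ ⟨i, rfl⟩
    exact (hf.adj i).1
  by_contra hne
  have hb := h.2 _ (hsub.ssubset_of_ne hne)
  obtain ⟨c, hc⟩ := hb
  have h1 := (alternating_eq_iff (b := fun i => c (f i)) (k := n) fun i _ => hc _ _
    (rimOn_mono hsub ⟨i, rfl⟩ ⟨i + 1, rfl⟩ (hf.adj i))).1
  have h2 := hf.periodic 0
  rw [zero_add] at h2
  exact (Nat.not_even_iff_odd.2 hf.odd) (h1 (congrArg c h2))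

theorem IsDiamondFree.induce {G : SimpleGraph V} (h : G.IsDiamondFree) (s : Set V) :
    (G.induce s).IsDiamondFree := fun hc =>
  h (hc.trans ⟨Embedding.induce s⟩)

theorem IsDiamondFree.adj_of_common {G : SimpleGraph V} (h : G.IsDiamondFree) {u v a b : V}
    (huv : G.Adj u v) (hau : G.Adj a u) (hav : G.Adj a v) (hbu : G.Adj b u) (hbv : G.Adj b v)
    (hab : a ≠ b) : G.Adj a b := by
  by_contra hnot
  apply h
  have hnot' : ¬ G.Adj b a := fun hc => hnot hc.symm
  have key : ∀ i j : Fin 4, G.Adj (![a, b, u, v] i) (![a, b, u, v] j) ↔ diamond.Adj i j := by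
    intro i j
    fin_cases i <;> fin_cases j <;>
      simp [diamond, huv, hau, hav, hbu, hbv, huv.symm, hau.symm, hav.symm, hbu.symm, hbv.symm,
        hnot, hnot']
  refine ⟨⟨⟨![a, b, u, v], ?_⟩, fun {i j} => key i j⟩⟩
  have := hau.ne
  have := hav.ne
  have := hbu.ne
  have := hbv.ne
  have := huv.ne
  intro i j hij
  fin_cases i <;> fin_cases j <;> simp_all

namespace IsMaxClique

variable {G : SimpleGraph V} {K L : Finset V}

theorem adj (hK : G.IsMaxClique K) {u v : V} (hu : u ∈ K) (hv : v ∈ K) (huv : u ≠ v) :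
    G.Adj u v := hK.2.1 hu hv huv

theorem mem_of_forall_adj (hK : G.IsMaxClique K) {w : V} (h : ∀ x ∈ K, w ≠ x → G.Adj w x) :
    w ∈ K := by
  classical
  have hcl : G.IsClique ((insert w K : Finset V) : Set V) := by
    rw [Finset.coe_insert, isClique_insert]
    exact ⟨hK.2.1, fun x hx hwx => h x hx hwx⟩
  exact hK.2.2 hcl (Finset.subset_insert w K) (Finset.mem_insert_self w K)

theorem mem_of_adj (hK : G.IsMaxClique K) (hG : G.IsDiamondFree) {u v w : V} (hu : u ∈ K)
    (hv : v ∈ K) (huv : u ≠ v) (hwu : G.Adj w u) (hwv : G.Adj w v) : w ∈ K := by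
  refine hK.mem_of_forall_adj fun x hx hwx => ?_
  by_cases hxu : x = u
  · rwa [hxu]
  by_cases hxv : x = v
  · rwa [hxv]
  exact hG.adj_of_common (hK.adj hu hv huv) hwu hwv (hK.adj hx hu hxu) (hK.adj hx hv hxv) hwx

/-- The main use of diamond-freeness: a common neighbour of two vertices of a maximal clique lies in
that clique, so an edge determines its maximal clique. -/
theorem eq_of_mem (hK : G.IsMaxClique K) (hL : G.IsMaxClique L) (hG : G.IsDiamondFree) {u v : V}
    (huK : u ∈ K) (hvK : v ∈ K) (huL : u ∈ L) (hvL : v ∈ L) (huv : u ≠ v) : K = L := by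
  have key : ∀ {K L : Finset V}, G.IsMaxClique K → G.IsMaxClique L → u ∈ K → v ∈ K → u ∈ L →
      v ∈ L → K ⊆ L := by
    intro K L hK hL huK hvK huL hvL w hw
    by_cases hwu : w = u
    · rwa [hwu]
    by_cases hwv : w = v
    · rwa [hwv]
    exact hL.mem_of_adj hG huL hvL huv (hK.adj hw huK hwu) (hK.adj hw hvK hwv)
  exact (key hK hL huK hvK huL hvL).antisymm (key hL hK huL hvL huK hvK)

end IsMaxClique

theorem exists_isMaxClique [Finite V] {G : SimpleGraph V} {s : Finset V} (hs : s.Nonempty)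
    (hcl : G.IsClique (s : Set V)) : ∃ K, G.IsMaxClique K ∧ s ⊆ K := by
  have := Fintype.ofFinite V
  obtain ⟨K, hsK, hK⟩ := (Set.toFinite {s : Finset V | G.IsClique (s : Set V)}).exists_le_maximal hcl
  exact ⟨K, ⟨hs.mono hsK, hK⟩, hsK⟩

theorem exists_isMaxClique_of_adj [Finite V] {G : SimpleGraph V} {u v : V} (h : G.Adj u v) :
    ∃ K, G.IsMaxClique K ∧ u ∈ K ∧ v ∈ K := by
  classical
  obtain ⟨K, hK, hsub⟩ := exists_isMaxClique (G := G) (s := {u, v}) (by simp)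
    (by simp [h])
  exact ⟨K, hK, hsub (by simp), hsub (by simp)⟩

/-- If a maximal clique meets `S` in exactly two vertices, these are adjacent in the rim of the
subgraph induced by `S`. -/
theorem IsMaxClique.rimOn_adj {G : SimpleGraph V} {K : Finset V} (hK : G.IsMaxClique K)
    (hG : G.IsDiamondFree) {S : Set V} {u v : V} (huS : u ∈ S) (hvS : v ∈ S) (hu : u ∈ K)
    (hv : v ∈ K) (huv : u ≠ v) (h : ∀ w ∈ S, w ∈ K → w = u ∨ w = v) : (G.rimOn S).Adj u v := by
  refine ⟨huS, hvS, hK.adj hu hv huv, fun w hw ⟨hwu, hwv⟩ => ?_⟩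
  rcases h w hw (hK.mem_of_adj hG hu hv huv hwu hwv) with rfl | rfl
  · exact hwu.ne rfl
  · exact hwv.ne rfl

end SimpleGraph

/-! ### Balanced incidence relations -/

/-- No odd cycle of length at least three occurs as a submatrix of the incidence matrix `I`. -/
def IsBalancedIncidence {X Y : Type*} (I : X → Y → Prop) : Prop :=
  ∀ (n : ℕ) (x : ℕ → X) (y : ℕ → Y), Odd n → 3 ≤ n → (∀ i, y (i + n) = y i) →
    (∀ i, I (x i) (y i) ∧ I (x (i + 1)) (y i)) →
    ¬ ∀ i j, I (x j) (y i) → j ≡ i [MOD n] ∨ j ≡ i + 1 [MOD n]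

/-- Joins two elements of `F` if they are the only ones in `F` incident with some `y`. -/
def pairGraph {X Y : Type*} (I : X → Y → Prop) (F : Finset X) : SimpleGraph X where
  Adj a b := a ≠ b ∧ a ∈ F ∧ b ∈ F ∧ ∃ y, I a y ∧ I b y ∧ ∀ z ∈ F, I z y → z = a ∨ z = b
  symm := ⟨fun _ _ h => ⟨h.1.symm, h.2.2.1, h.2.1, h.2.2.2.imp fun _ hy =>
    ⟨hy.2.1, hy.1, fun z hz hzy => (hy.2.2 z hz hzy).symm⟩⟩⟩
  loopless := ⟨fun _ h => h.1 rfl⟩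

/-- In a bipartite graph some vertex `x` is not a cut vertex of its component, so that its
neighbours get the same colour in each proper 2-colouring of the graph without `x`. -/
theorem SimpleGraph.exists_forall_two_coloring_eq {X : Type*} (Q : SimpleGraph X) {F : Finset X}
    (hQF : ∀ u v, Q.Adj u v → u ∈ F ∧ v ∈ F) (hF : F.Nonempty) (hQ : Q.IsTwoColorable) :
    ∃ x ∈ F, ∀ c : X → Bool, (∀ u v, Q.Adj u v → u ≠ x → v ≠ x → c u ≠ c v) →
      ∀ u v, Q.Adj x u → Q.Adj x v → c u = c v := by
  classical
  obtain ⟨r, hr⟩ := hF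
  obtain ⟨d, hd⟩ := hQ
  -- Since `x` is farthest from `r` in its component, shortest paths from `r` to the other vertices
  -- avoid `x`.
  obtain ⟨x, hxF, hxmax⟩ := Finset.exists_max_image (F.filter fun z => Q.Reachable r z)
    (fun z => Q.dist r z) ⟨r, by simp [hr]⟩
  rw [Finset.mem_filter] at hxF
  obtain ⟨hxF, hrx⟩ := hxF
  refine ⟨x, hxF, fun c hstep => ?_⟩
  have hxor : ∀ a b p q : Bool, a ≠ b → p ≠ q → (a ^^ p) = (b ^^ q) := by decide
  have hxor' : ∀ a b p q : Bool, (a ^^ p) = (b ^^ q) → p = q → a = b := by decide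
  have hbool : ∀ p q r : Bool, p ≠ q → p ≠ r → q = r := by decide
  -- Both `c` and `d` change along every edge of such a path, so their xor is constant; neighbours
  -- of `x` agree in `d`, hence in `c`.
  have hflip : ∀ k v, Q.dist r v = k → Q.Reachable r v → v ∈ F → v ≠ x → r ≠ x →
      (c v ^^ d v) = (c r ^^ d r) := by
    intro k
    induction k with
    | zero =>
      intro v hk hrv _ _ _
      rw [hrv.dist_eq_zero_iff] at hk
      rw [hk]
    | succ k ihk =>
      intro v hk hrv hv hvx hrxne
      obtain ⟨w, hw⟩ := hrv.exists_walk_length_eq_dist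
      have hw1 : w.length = k + 1 := by omega
      have huv : Q.Adj (w.getVert k) v := by
        have := w.adj_getVert_succ (i := k) (by omega)
        rwa [← hw1, w.getVert_length] at this
      have hru : Q.Reachable r (w.getVert k) := ⟨w.take k⟩
      have hdu : Q.dist r (w.getVert k) ≤ k := (dist_le (w.take k)).trans (by simp)
      have hdu' : Q.dist r (w.getVert k) = k := by
        obtain ⟨w', hw'⟩ := hru.exists_walk_length_eq_dist
        have h1 := dist_le (w'.concat huv)
        rw [Walk.length_concat, hw'] at h1
        omega
      have hux : w.getVert k ≠ x := by
        intro he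
        have h1 := hxmax v (by simp [hv, hrv])
        rw [hk, ← he] at h1
        omega
      rw [← ihk _ hdu' hru (hQF _ _ huv).1 hux hrxne]
      exact (hxor _ _ _ _ (hstep _ v huv hux hvx) (hd _ v huv)).symm
  intro u v hxu hxv
  have hrxne : r ≠ x := by
    rintro rfl
    have h1 := hxmax u (by simp [(hQF _ _ hxu).2, hxu.reachable])
    rw [dist_self, dist_eq_one_iff_adj.2 hxu] at h1
    omega
  have h1 := hflip _ u rfl (hrx.trans hxu.reachable) (hQF _ _ hxu).2 hxu.ne.symm hrxne
  have h2 := hflip _ v rfl (hrx.trans hxv.reachable) (hQF _ _ hxv).2 hxv.ne.symm hrxne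
  exact hxor' _ _ _ _ (h1.trans h2.symm) (hbool _ _ _ (hd x u hxu) (hd x v hxv))

namespace IsBalancedIncidence

variable {X Y : Type*} {I : X → Y → Prop}

/-- An induced odd cycle of the pair graph, with a witness `y` chosen for each edge, is exactly an
excluded submatrix. The witnesses are made periodic by reducing indices mod `n`. -/
theorem pairGraph_isTwoColorable (h : IsBalancedIncidence I) (F : Finset X) :
    (pairGraph I F).IsTwoColorable := by
  by_contra hcon
  obtain ⟨n, f, hf⟩ := SimpleGraph.exists_isInducedOddCycle hcon
  choose y hy using fun i => (hf.adj i).2.2.2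
  have hs : ∀ i, f (i % n + 1) = f (i + 1) := fun i =>
    hf.eq_iff.2 ((Nat.mod_modEq i n).add_right 1)
  refine h n f (fun i => y (i % n)) hf.odd hf.three_le (fun i => by simp) (fun i => ⟨?_, ?_⟩)
    fun i j hij => ?_
  · have := (hy (i % n)).1
    rwa [hf.mod] at this
  · have := (hy (i % n)).2.1
    rwa [hs] at this
  · have := (hy (i % n)).2.2 _ (hf.adj j).2.1 hij
    rwa [hf.mod, hs, hf.eq_iff, hf.eq_iff] at this

/-- Berge: a balanced incidence relation has a bicolouring. -/
theorem exists_bicoloring (h : IsBalancedIncidence I) (F : Finset X) :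
    ∃ c : X → Bool, ∀ y, (∃ a ∈ F, ∃ b ∈ F, a ≠ b ∧ I a y ∧ I b y) →
      ∃ a ∈ F, ∃ b ∈ F, I a y ∧ I b y ∧ c a ≠ c b := by
  classical
  induction hm : F.card generalizing F with
  | zero =>
    rw [Finset.card_eq_zero] at hm
    subst hm
    exact ⟨fun _ => true, fun y hy => by simp at hy⟩
  | succ m ih =>
    obtain ⟨r, hr⟩ : F.Nonempty := Finset.card_pos.1 (by omega)
    set Q := pairGraph I F with hQ
    obtain ⟨x, hxF, hx⟩ := Q.exists_forall_two_coloring_eq (fun u v huv => ⟨huv.2.1, huv.2.2.1⟩)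
      ⟨r, hr⟩ (h.pairGraph_isTwoColorable F)
    obtain ⟨c, hc⟩ := ih (F.erase x) (by rw [Finset.card_erase_of_mem hxF, hm]; rfl)
    have hstep : ∀ u v, Q.Adj u v → u ≠ x → v ≠ x → c u ≠ c v := by
      rintro u v ⟨huv, hu, hv, y, huy, hvy, hy⟩ hux hvx
      obtain ⟨a, ha, b, hb, hay, hby, hab⟩ := hc y ⟨u, Finset.mem_erase.2 ⟨hux, hu⟩, v,
        Finset.mem_erase.2 ⟨hvx, hv⟩, huv, huy, hvy⟩
      rcases hy a (Finset.mem_of_mem_erase ha) hay with rfl | rfl <;>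
        rcases hy b (Finset.mem_of_mem_erase hb) hby with rfl | rfl
      · exact absurd rfl hab
      · exact hab
      · exact hab.symm
      · exact absurd rfl hab
    have hnb := hx c hstep
    -- The colour opposite to the common colour of the neighbours of `x`. It settles every `y`
    -- incident with `x` and just one other element of `F`.
    obtain ⟨t, ht⟩ : ∃ t : Bool, ∀ u, Q.Adj x u → c u ≠ t := by
      by_cases hex : ∃ u, Q.Adj x u
      · obtain ⟨u, hu⟩ := hex
        exact ⟨!c u, fun v hv => by rw [hnb v u hv hu]; simp⟩
      · exact ⟨true, fun u hu => absurd ⟨u, hu⟩ hex⟩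
    refine ⟨Function.update c x t, fun y hy => ?_⟩
    by_cases h2 : ∃ a ∈ F.erase x, ∃ b ∈ F.erase x, a ≠ b ∧ I a y ∧ I b y
    · obtain ⟨a, ha, b, hb, hay, hby, hab⟩ := hc y h2
      refine ⟨a, Finset.mem_of_mem_erase ha, b, Finset.mem_of_mem_erase hb, hay, hby, ?_⟩
      rwa [Function.update_of_ne (Finset.ne_of_mem_erase ha),
        Function.update_of_ne (Finset.ne_of_mem_erase hb)]
    · have key : ∀ u ∈ F, u ≠ x → I u y → I x y →
          ∃ a ∈ F, ∃ b ∈ F, I a y ∧ I b y ∧ Function.update c x t a ≠ Function.update c x t b := by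
        intro u hu hux huy hxy
        refine ⟨u, hu, x, hxF, huy, hxy, ?_⟩
        rw [Function.update_of_ne hux, Function.update_self]
        refine ht u ⟨hux.symm, hxF, hu, y, hxy, huy, fun z hz hzy => ?_⟩
        by_contra hcon
        rw [not_or] at hcon
        exact h2 ⟨z, Finset.mem_erase.2 ⟨hcon.1, hz⟩, u, Finset.mem_erase.2 ⟨hux, hu⟩, hcon.2,
          hzy, huy⟩
      obtain ⟨a, ha, b, hb, hab, hay, hby⟩ := hy
      by_cases hax : a = x
      · exact key b hb (fun hc => hab (hax.trans hc.symm)) hby (hax ▸ hay)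
      · by_cases hbx : b = x
        · exact key a ha hax hay (hbx ▸ hby)
        · exact absurd ⟨a, Finset.mem_erase.2 ⟨hax, ha⟩, b, Finset.mem_erase.2 ⟨hbx, hb⟩, hab,
            hay, hby⟩ h2

/-- A balanced incidence relation on a finite type, all of whose degrees are at most `k`, has a
colouring with `k` colours in which elements with a common neighbour get different colours. -/
theorem exists_coloring [Fintype X] [Fintype Y] [DecidableRel I] (h : IsBalancedIncidence I)
    {k : ℕ} (hk : 0 < k) (hdeg : ∀ y, (Finset.univ.filter fun x => I x y).card ≤ k) :
    ∃ col : X → Fin k, ∀ y a b, I a y → I b y → col a = col b → a = b := by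
  classical
  have : Nonempty (X → Fin k) := ⟨fun _ => ⟨0, hk⟩⟩
  let D : Y → Finset X := fun y => Finset.univ.filter fun x => I x y
  -- Extremal choice: maximise the total number of colours seen. A repeated colour `i` at `y₀`
  -- leaves some colour `j` absent there, and a bicolouring of the union of these two classes would
  -- raise the total.
  obtain ⟨col, hcol⟩ := Finite.exists_max
    fun col : X → Fin k => ∑ y : Y, ((D y).image col).card
  refine ⟨col, ?_⟩
  by_contra hcon
  push Not at hcon
  obtain ⟨y₀, a, b, hay, hby, hab, hne⟩ := hcon
  have hlt : ((D y₀).image col).card < (D y₀).card := by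
    refine lt_of_le_of_ne Finset.card_image_le fun he => hne ?_
    exact Finset.card_image_iff.1 he (by simp [D, hay]) (by simp [D, hby]) hab
  obtain ⟨j, hj⟩ : ∃ j, j ∉ (D y₀).image col := by
    by_contra hall
    push Not at hall
    have h1 : (D y₀).image col = Finset.univ := Finset.eq_univ_of_forall hall
    rw [h1, Finset.card_univ, Fintype.card_fin] at hlt
    exact absurd hlt (not_lt.2 (hdeg y₀))
  set i := col a with hi
  have hij : i ≠ j := fun he => hj (he ▸ Finset.mem_image.2 ⟨a, by simp [D, hay], rfl⟩)
  obtain ⟨c, hc⟩ := h.exists_bicoloring (Finset.univ.filter fun x => col x = i ∨ col x = j)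
  let col' : X → Fin k := fun x => if col x = i ∨ col x = j then (if c x then i else j) else col x
  have hother : ∀ x, ¬ (col x = i ∨ col x = j) → col' x = col x := fun x hx => by
    simp [col', hx]
  have hin : ∀ x, (col x = i ∨ col x = j) → col' x = if c x then i else j := fun x hx => by
    simp only [col', if_pos hx]
  have hboth : ∀ y, (∃ p q, p ≠ q ∧ I p y ∧ I q y ∧ (col p = i ∨ col p = j) ∧
      (col q = i ∨ col q = j)) → i ∈ (D y).image col' ∧ j ∈ (D y).image col' := by
    rintro y ⟨p, q, hpq, hpy, hqy, hp, hq⟩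
    obtain ⟨u, hu, v, hv, huy, hvy, huv⟩ := hc y ⟨p, by simpa using hp, q, by simpa using hq, hpq,
      hpy, hqy⟩
    simp only [Finset.mem_filter, Finset.mem_univ, true_and] at hu hv
    have hu' := hin u hu
    have hv' := hin v hv
    simp only [Finset.mem_image, D, Finset.mem_filter, Finset.mem_univ, true_and]
    cases hcu : c u <;> cases hcv : c v
    · simp [hcu, hcv] at huv
    · exact ⟨⟨v, hvy, by simp [hv', hcv]⟩, ⟨u, huy, by simp [hu', hcu]⟩⟩
    · exact ⟨⟨u, huy, by simp [hu', hcu]⟩, ⟨v, hvy, by simp [hv', hcv]⟩⟩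
    · simp [hcu, hcv] at huv
  have hrest : ∀ y l, l ≠ i → l ≠ j → l ∈ (D y).image col → l ∈ (D y).image col' := by
    intro y l hli hlj hl
    obtain ⟨p, hp, rfl⟩ := Finset.mem_image.1 hl
    exact Finset.mem_image.2 ⟨p, hp, hother p (by tauto)⟩
  have hle : ∀ y, ((D y).image col).card ≤ ((D y).image col').card := by
    intro y
    by_cases h2 : ∃ p q, p ≠ q ∧ I p y ∧ I q y ∧ (col p = i ∨ col p = j) ∧ (col q = i ∨ col q = j)
    · refine Finset.card_le_card fun l hl => ?_
      by_cases hli : l = i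
      · rw [hli]
        exact (hboth y h2).1
      by_cases hlj : l = j
      · rw [hlj]
        exact (hboth y h2).2
      exact hrest y l hli hlj hl
    · have huniq : ∀ p q, I p y → I q y → (col p = i ∨ col p = j) → (col q = i ∨ col q = j) →
          p = q := fun p q hp hq hp' hq' => by
        by_contra hpq
        exact h2 ⟨p, q, hpq, hp, hq, hp', hq'⟩
      -- At most one element at `y` is coloured `i` or `j`, so sending a colour to the new colour of
      -- one of its bearers is injective. The default `l` is never reached on the image.
      refine Finset.card_le_card_of_injOn
        (fun l => if hl : ∃ p, I p y ∧ col p = l then col' hl.choose else l) ?_ ?_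
      · intro l hl
        obtain ⟨p, hp, hpl⟩ := Finset.mem_image.1 hl
        have hex : ∃ p, I p y ∧ col p = l := ⟨p, by simpa [D] using hp, hpl⟩
        dsimp only
        rw [dif_pos hex]
        exact Finset.mem_coe.2 (Finset.mem_image.2 ⟨_, by simpa [D] using hex.choose_spec.1, rfl⟩)
      · intro l hl l' hl' hll
        obtain ⟨p, hp, hpl⟩ := Finset.mem_image.1 hl
        obtain ⟨p', hp', hpl'⟩ := Finset.mem_image.1 hl'
        have hex : ∃ p, I p y ∧ col p = l := ⟨p, by simpa [D] using hp, hpl⟩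
        have hex' : ∃ p, I p y ∧ col p = l' := ⟨p', by simpa [D] using hp', hpl'⟩
        dsimp only at hll
        rw [dif_pos hex, dif_pos hex'] at hll
        obtain ⟨hq, hql⟩ := hex.choose_spec
        obtain ⟨hq', hql'⟩ := hex'.choose_spec
        set q := hex.choose
        set q' := hex'.choose
        have hval : ∀ x, (col x = i ∨ col x = j) → (col' x = i ∨ col' x = j) := fun x hx => by
          rw [hin x hx]
          split_ifs <;> simp
        by_cases hA : col q = i ∨ col q = j <;> by_cases hB : col q' = i ∨ col q' = j
        · rw [← hql, ← hql', huniq q q' hq hq' hA hB]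
        · exact absurd (by rw [← hother q' hB, ← hll]; exact hval q hA) hB
        · exact absurd (by rw [← hother q hA, hll]; exact hval q' hB) hA
        · rw [← hql, ← hql', ← hother q hA, ← hother q' hB, hll]
  have hstrict : ((D y₀).image col).card < ((D y₀).image col').card := by
    have h2 := hboth y₀ ⟨a, b, hne, hay, hby, Or.inl rfl, Or.inl hab.symm⟩
    refine Finset.card_lt_card ⟨fun l hl => ?_, fun hc => hj (hc h2.2)⟩
    by_cases hli : l = i
    · rw [hli]
      exact h2.1
    by_cases hlj : l = j
    · rw [hlj]
      exact h2.2
    exact hrest y₀ l hli hlj hl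
  exact absurd (hcol col') (not_le.2 (Finset.sum_lt_sum (fun y _ => hle y) ⟨y₀, by simp, hstrict⟩))

end IsBalancedIncidence

/-- Berge and Las Vergnas: balanced hypergraphs have the König property. -/
theorem IsBalancedIncidence.exists_transversal_matching {V : Type*} [Fintype V]
    {E : Set (Finset V)} (h : IsBalancedIncidence fun (K : Finset V) v => K ∈ E ∧ v ∈ K)
    (F : Finset (Finset V)) (hF : ∀ K ∈ F, K.Nonempty ∧ K ∈ E) :
    ∃ (T : Finset V) (M : Finset (Finset V)), M ⊆ F ∧ (M : Set (Finset V)).PairwiseDisjoint id ∧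
      (∀ K ∈ F, ∃ v ∈ T, v ∈ K) ∧ T.card ≤ M.card := by
  classical
  induction hm : F.card using Nat.strong_induction_on generalizing F with
  | _ m ih =>
    rcases F.eq_empty_or_nonempty with rfl | ⟨K₀, hK₀⟩
    · exact ⟨∅, ∅, by simp⟩
    let P : Finset (Finset (Finset V)) :=
      F.powerset.filter fun M => (M : Set (Finset V)).PairwiseDisjoint id
    have hP : ∀ M, M ∈ P ↔ M ⊆ F ∧ (M : Set (Finset V)).PairwiseDisjoint id := by simp [P]
    obtain ⟨M₀, hM₀, hmax⟩ := Finset.exists_max_image P Finset.card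
      ⟨∅, by rw [hP]; simp⟩
    have hpos : 0 < M₀.card := by
      have := hmax {K₀} (by rw [hP]; simp [hK₀])
      simp only [Finset.card_singleton] at this
      omega
    -- A vertex met by every maximum matching can be put into the transversal: deleting the edges
    -- through it lowers the matching number. If there is none, each `v` is avoided by some maximum
    -- matching `M v`.
    by_cases hv : ∃ v, ∀ M ∈ P, M.card = M₀.card → ∃ K ∈ M, v ∈ K
    · obtain ⟨v, hv⟩ := hv
      have hlt : (F.filter fun K => v ∉ K).card < m := by
        obtain ⟨K, hK, hvK⟩ := hv M₀ hM₀ rfl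
        rw [← hm]
        refine Finset.card_lt_card (Finset.filter_ssubset.2 ⟨K, ((hP _).1 hM₀).1 hK, ?_⟩)
        simpa using hvK
      obtain ⟨T, M, hMF, hM, hT, hTM⟩ := ih _ hlt (F.filter fun K => v ∉ K)
        (fun K hK => hF K (Finset.mem_of_mem_filter K hK)) rfl
      have hMP : M ∈ P := (hP M).2 ⟨hMF.trans (Finset.filter_subset _ _), hM⟩
      have hlt' : M.card < M₀.card := by
        refine lt_of_le_of_ne (hmax M hMP) fun he => ?_
        obtain ⟨K, hK, hvK⟩ := hv M hMP he
        exact (Finset.mem_filter.1 (hMF hK)).2 hvK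
      refine ⟨insert v T, M₀, ((hP _).1 hM₀).1, ((hP _).1 hM₀).2, fun K hK => ?_,
        (Finset.card_insert_le v T).trans (by omega)⟩
      by_cases hvK : v ∈ K
      · exact ⟨v, by simp, hvK⟩
      · obtain ⟨u, hu, huK⟩ := hT K (Finset.mem_filter.2 ⟨hK, hvK⟩)
        exact ⟨u, by simp [hu], huK⟩
    · exfalso
      push Not at hv
      choose M hMP hMcard hMv using hv
      have hMF : ∀ {v K}, K ∈ M v → K ∈ F := fun {v} _ hK => ((hP _).1 (hMP v)).1 hK
      have hMd : ∀ {v K L w}, K ∈ M v → L ∈ M v → w ∈ K → w ∈ L → K = L := by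
        intro v K L w hK hL hwK hwL
        by_contra hne
        exact Finset.disjoint_left.1 (((hP _).1 (hMP v)).2 hK hL hne) hwK hwL
      -- Edges are counted with multiplicity, once for each matching that contains them; repeating
      -- edges preserves balancedness.
      let X := Σ v : V, {K // K ∈ M v}
      have hbal : IsBalancedIncidence fun (x : X) (v : V) => v ∈ x.2.1 := by
        intro n x y hn hn3 hy hinc hno
        exact h n (fun i => (x i).2.1) y hn hn3 hy
          (fun i => ⟨⟨(hF _ (hMF (x i).2.2)).2, (hinc i).1⟩,
            (hF _ (hMF (x (i + 1)).2.2)).2, (hinc i).2⟩) fun i j hij => hno i j hij.2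
      obtain ⟨v₀, -⟩ := (hF K₀ hK₀).1
      have hn : 2 ≤ Fintype.card V := by
        obtain ⟨K, hK⟩ := Finset.card_pos.1 (by rw [hMcard v₀]; exact hpos)
        obtain ⟨w, hw⟩ := (hF K (hMF hK)).1
        refine Fintype.one_lt_card_iff.2 ⟨v₀, w, ?_⟩
        rintro rfl
        exact hMv v₀ K hK hw
      -- The degree at `y` is at most `|V| - 1`: the matching `M y` avoids `y` and every other one
      -- covers it at most once.
      obtain ⟨col, hcol⟩ := hbal.exists_coloring (k := Fintype.card V - 1) (by omega) (by
        intro y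
        rw [← Finset.card_univ (α := V), ← Finset.card_erase_of_mem (Finset.mem_univ y)]
        refine Finset.card_le_card_of_injOn (fun x => x.1) ?_ ?_
        · rintro ⟨v, K, hK⟩ hx
          simp only [Finset.coe_filter, Finset.mem_univ, true_and, Set.mem_ofPred_eq] at hx
          simp only [Finset.coe_erase, Finset.coe_univ, Set.mem_sdiff, Set.mem_univ, true_and,
            Set.mem_singleton_iff]
          rintro rfl
          exact hMv v K hK hx
        · rintro ⟨v, K, hK⟩ hx ⟨v', K', hK'⟩ hx' hvv
          simp only [Finset.coe_filter, Finset.mem_univ, true_and, Set.mem_ofPred_eq] at hx hx'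
          dsimp only at hvv
          subst hvv
          obtain rfl := hMd hK hK' hx hx'
          rfl)
      have hclass : ∀ i, (Finset.univ.filter fun x : X => col x = i).card ≤ M₀.card := by
        intro i
        have hinj : Set.InjOn (fun x : X => x.2.1)
            (Finset.univ.filter fun x : X => col x = i : Finset X) := by
          intro x hx x' hx' he
          simp only [Finset.coe_filter, Finset.mem_univ, true_and, Set.mem_ofPred_eq] at hx hx'
          obtain ⟨w, hw⟩ := (hF _ (hMF x.2.2)).1
          exact hcol w x x' hw (by rw [← show x.2.1 = x'.2.1 from he]; exact hw) (hx.trans hx'.symm)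
        rw [← Finset.card_image_of_injOn hinj]
        refine hmax _ ((hP _).2 ⟨fun K hK => ?_, fun K hK K' hK' hne => ?_⟩)
        · obtain ⟨x, -, rfl⟩ := Finset.mem_image.1 hK
          exact hMF x.2.2
        · obtain ⟨x, hx, rfl⟩ := Finset.mem_image.1 (Finset.mem_coe.1 hK)
          obtain ⟨x', hx', rfl⟩ := Finset.mem_image.1 (Finset.mem_coe.1 hK')
          refine Finset.disjoint_left.2 fun w hw hw' => hne ?_
          rw [hcol w x x' hw hw'
            ((Finset.mem_filter.1 hx).2.trans (Finset.mem_filter.1 hx').2.symm)]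
      have htot : Fintype.card X = Fintype.card V * M₀.card := by
        rw [Fintype.card_sigma]
        simp [hMcard]
      -- There are `|V| - 1` colour classes, each a matching and thus of size at most `M₀.card`, too
      -- few for `|V| * M₀.card` edges.
      have hle : Fintype.card X ≤ (Fintype.card V - 1) * M₀.card := by
        rw [← Finset.card_univ (α := X), Finset.card_eq_sum_card_fiberwise
          (f := col) (t := Finset.univ) (fun _ _ => by simp)]
        exact (Finset.sum_le_sum fun i _ => hclass i).trans (by simp)
      rw [htot] at hle
      have := Nat.le_of_mul_le_mul_right hle hpos
      omega

/-! ### Clique-perfection and bipartite rims -/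

namespace SimpleGraph

variable {V : Type*}

/-- On the set `S` of vertices of an odd cycle submatrix, `x (i + 1)` meets `S` only in `y i` and `y
(i + 1)`. These form a rim edge of `S`, so a 2-colouring would alternate around an odd cycle. -/
theorem isBalancedIncidence_isMaxClique {G : SimpleGraph V}
    (hG : G.IsDiamondFree) (h : ∀ S, G.IsRimBipartite S) :
    IsBalancedIncidence fun (K : Finset V) v => K ∈ {K | G.IsMaxClique K} ∧ v ∈ K := by
  intro n x y hn hn3 hy hinc hno
  obtain ⟨c, hc⟩ := h (Set.range y)
  have hyeq : ∀ i j, i ≡ j [MOD n] → y i = y j := by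
    have hmod : ∀ i, y (i % n) = y i := fun i => Function.Periodic.map_mod_nat hy i
    intro i j hij
    rw [← hmod i, ← hmod j, hij]
  have hne : ∀ i, y i ≠ y (i + 1) := by
    intro i he
    have h1 := hno (i + 1) i ⟨(hinc i).1.1, he ▸ (hinc i).1.2⟩
    rcases h1 with h1 | h1
    · have h2 := (Nat.modEq_iff_dvd' (by omega)).1 h1
      rw [show i + 1 - i = 1 by omega] at h2
      have := Nat.le_of_dvd one_pos h2
      omega
    · have h2 := (Nat.modEq_iff_dvd' (by omega)).1 h1
      rw [show i + 1 + 1 - i = 2 by omega] at h2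
      have := Nat.le_of_dvd two_pos h2
      omega
  have halt : ∀ i < n, c (y i) ≠ c (y (i + 1)) := by
    intro i _
    refine hc _ _ (IsMaxClique.rimOn_adj (hinc i).2.1 hG ⟨i, rfl⟩ ⟨i + 1, rfl⟩ (hinc i).2.2
      (hinc (i + 1)).1.2 (hne i) ?_)
    rintro _ ⟨j, rfl⟩ hj
    rcases hno j (i + 1) ⟨(hinc i).2.1, hj⟩ with h1 | h1
    · exact Or.inr (hyeq _ _ h1.symm)
    · exact Or.inl (hyeq _ _ (Nat.ModEq.add_right_cancel' 1 h1).symm)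
  have h2 := (alternating_eq_iff (b := fun i => c (y i)) halt).1
  have h3 := hy 0
  rw [zero_add] at h3
  exact (Nat.not_even_iff_odd.2 hn) (h2 (congrArg c h3))

theorem cliqueIndependenceNum_le_cliqueTransversalNum [Finite V] (G : SimpleGraph V) :
    G.cliqueIndependenceNum ≤ G.cliqueTransversalNum := by
  obtain ⟨T, hT, hTc⟩ := G.cliqueTransversalNum_isLeast.1
  obtain ⟨F, hF, hFc⟩ := G.cliqueIndependenceNum_isGreatest.1
  rw [← hTc, ← hFc]
  refine Finset.card_le_card_of_forall_subsingleton (fun K v => v ∈ K)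
    (fun K hK => hT K (hF.1 K hK)) fun v _ K hK L hL => ?_
  by_contra hne
  exact Finset.disjoint_left.1 (hF.2 hK.1 hL.1 hne) hK.2 hL.2

theorem cliqueTransversalNum_eq_of_forall_isRimBipartite [Finite V] {G : SimpleGraph V}
    (hG : G.IsDiamondFree) (h : ∀ S, G.IsRimBipartite S) :
    G.cliqueTransversalNum = G.cliqueIndependenceNum := by
  classical
  have := Fintype.ofFinite V
  refine le_antisymm ?_ G.cliqueIndependenceNum_le_cliqueTransversalNum
  obtain ⟨T, M, hMF, hM, hT, hle⟩ := (isBalancedIncidence_isMaxClique hG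
    h).exists_transversal_matching (Finset.univ.filter fun K => G.IsMaxClique K)
      (fun K hK => ⟨(Finset.mem_filter.1 hK).2.1, (Finset.mem_filter.1 hK).2⟩)
  refine (G.cliqueTransversalNum_isLeast.2 ⟨T, fun K hK => hT K (by simpa using hK), rfl⟩).trans
    (hle.trans (G.cliqueIndependenceNum_isGreatest.2 ⟨M, ⟨fun K hK => ?_, hM⟩, rfl⟩))
  exact (Finset.mem_filter.1 (hMF hK)).2

/-- A graph with an odd spanning cycle of maximal cliques of size two. -/
theorem cliqueTransversalNum_ne_of_isMinimalOddRim [Finite V] {G : SimpleGraph V}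
    (h : G.IsMinimalOddRim Set.univ) : G.cliqueTransversalNum ≠ G.cliqueIndependenceNum := by
  classical
  have := Fintype.ofFinite V
  obtain ⟨n, f, hf, hrange⟩ := h.exists_cycle
  rw [rimOn_univ] at hf
  have hcard : Fintype.card V = n := by
    have hbij : Function.Bijective fun i : Fin n => f i := by
      refine ⟨fun i j hij => ?_, fun v => ?_⟩
      · exact Fin.ext (hf.inj_of_lt hij (by omega) (by omega))
      · obtain ⟨i, rfl⟩ := (Set.range_eq_univ.1 hrange) v
        exact ⟨⟨i % n, Nat.mod_lt _ hf.pos⟩, hf.mod i⟩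
    rw [← Fintype.card_of_bijective hbij, Fintype.card_fin]
  obtain ⟨T, hT, hTc⟩ := G.cliqueTransversalNum_isLeast.1
  obtain ⟨F, hF, hFc⟩ := G.cliqueIndependenceNum_isGreatest.1
  -- Each of the `n` rim edges meets `T`, and each vertex of `T` lies on two of them.
  have h1 : n ≤ 2 * T.card := by
    have hmem : ∀ i, f i ∈ T ∨ f (i + 1) ∈ T := by
      intro i
      obtain ⟨-, K, hK, hKe⟩ := hf.adj i
      obtain ⟨v, hv, hvK⟩ := hT K hK
      rw [← Finset.mem_coe, hKe] at hvK
      rcases hvK with rfl | rfl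
      · exact Or.inl hv
      · exact Or.inr hv
    have hA : ((Finset.range n).filter fun i => f i ∈ T).card ≤ T.card :=
      Finset.card_le_card_of_injOn f (fun i hi => (Finset.mem_filter.1 hi).2)
        fun i hi j hj hij => by
          have := Finset.mem_range.1 (Finset.mem_filter.1 hi).1
          have := Finset.mem_range.1 (Finset.mem_filter.1 hj).1
          exact hf.inj_of_lt hij (by omega) (by omega)
    have hB : ((Finset.range n).filter fun i => f (i + 1) ∈ T).card ≤ T.card :=
      Finset.card_le_card_of_injOn (fun i => f (i + 1)) (fun i hi => (Finset.mem_filter.1 hi).2)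
        fun i hi j hj hij => by
          have := Finset.mem_range.1 (Finset.mem_filter.1 hi).1
          have := Finset.mem_range.1 (Finset.mem_filter.1 hj).1
          have := hf.inj_of_lt hij (by omega) (by omega)
          omega
    have hC : (Finset.range n) ⊆ ((Finset.range n).filter fun i => f i ∈ T) ∪
        ((Finset.range n).filter fun i => f (i + 1) ∈ T) := by
      intro i hi
      rcases hmem i with h | h <;> simp [h, Finset.mem_range.1 hi]
    have := (Finset.card_le_card hC).trans (Finset.card_union_le _ _)
    rw [Finset.card_range] at this
    omega
  -- No vertex is isolated, so every maximal clique has at least two vertices.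
  have h2 : 2 * F.card ≤ n := by
    have hK2 : ∀ K ∈ F, 2 ≤ (id K).card := by
      intro K hK
      have hKm := hF.1 K hK
      by_contra hlt
      have h1 : K.card = 1 := by
        have := hKm.1.card_pos
        simp only [id] at hlt
        omega
      obtain ⟨v, rfl⟩ := Finset.card_eq_one.1 h1
      obtain ⟨i, rfl⟩ := (Set.range_eq_univ.1 hrange) v
      have hadj := (rim_adj_iff.1 (hf.adj i)).1
      have h3 := hKm.mem_of_forall_adj (w := f (i + 1)) fun x hx _ => by
        rw [Finset.mem_singleton.1 hx]
        exact hadj.symm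
      exact hadj.ne (Finset.mem_singleton.1 h3).symm
    have h3 := Finset.card_biUnion hF.2
    have h4 := Finset.card_le_univ (F.biUnion id)
    have h5 := Finset.sum_le_sum hK2
    rw [Finset.sum_const, smul_eq_mul] at h5
    rw [hcard, h3] at h4
    omega
  obtain ⟨k, hk⟩ := hf.odd
  omega

/-- A diamond-free graph is clique-perfect if and only if all its induced subgraphs have bipartite
rims. -/
theorem isCliquePerfect_iff [Finite V] {G : SimpleGraph V} (hG : G.IsDiamondFree) :
    G.IsCliquePerfect ↔ ∀ S, G.IsRimBipartite S := by
  constructor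
  · intro hp S
    by_contra hS
    obtain ⟨T, -, hT⟩ := exists_isMinimalOddRim hS
    exact cliqueTransversalNum_ne_of_isMinimalOddRim (isMinimalOddRim_induce.2 hT) (hp T)
  · intro h s
    exact cliqueTransversalNum_eq_of_forall_isRimBipartite (hG.induce s) fun S =>
      isRimBipartite_induce.2 (h _)

theorem IsMinimalOddRim.isMinimallyCliqueImperfect [Finite V] {G : SimpleGraph V}
    (hG : G.IsDiamondFree) (h : G.IsMinimalOddRim Set.univ) : G.IsMinimallyCliqueImperfect := by
  refine ⟨fun hp => h.1 ((isCliquePerfect_iff hG).1 hp _), fun s hs => ?_⟩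
  rw [isCliquePerfect_iff (hG.induce s)]
  intro S
  rw [isRimBipartite_induce]
  refine h.2 _ ⟨Set.subset_univ _, fun hc => hs (Set.eq_univ_of_forall fun x => ?_)⟩
  obtain ⟨y, -, hy⟩ := hc (Set.mem_univ x)
  exact hy ▸ y.2

end SimpleGraph

namespace SimpleGraph

variable {V : Type*}

/-! ### Multisuns and their rims -/

theorem fin_sub_val_eq_one_iff {n : ℕ} (hn : 2 ≤ n) (u v : Fin n) :
    (v - u).val = 1 ↔ v.val ≡ u.val + 1 [MOD n] := by
  rw [Fin.val_sub]
  have h1 : (n - u.val + v.val) % n = 1 ↔ n - u.val + v.val ≡ 1 [MOD n] := by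
    rw [Nat.ModEq, Nat.mod_eq_of_lt (show 1 < n by omega)]
  rw [h1, ← Nat.ModEq.add_iff_left (a := u.val) (b := u.val) rfl]
  have h2 : u.val + (n - u.val + v.val) = n + v.val := by omega
  rw [h2]
  unfold Nat.ModEq
  rw [Nat.add_mod_left, add_comm]

theorem cycleGraph_adj_iff {n : ℕ} (hn : 2 ≤ n) (u v : Fin n) :
    (cycleGraph n).Adj u v ↔ v.val ≡ u.val + 1 [MOD n] ∨ u.val ≡ v.val + 1 [MOD n] := by
  rw [cycleGraph_adj', fin_sub_val_eq_one_iff hn, fin_sub_val_eq_one_iff hn, or_comm]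

theorem exists_isInducedOddCycle_of_iso {R : SimpleGraph V} {n : ℕ} (hn : 3 ≤ n) (ho : Odd n)
    (e : cycleGraph n ≃g R) : ∃ f, R.IsInducedOddCycle n f ∧ Set.range f = Set.univ := by
  have hm : ∀ i, i % n < n := fun i => Nat.mod_lt _ (by omega)
  refine ⟨fun i => e ⟨i % n, hm i⟩, ⟨ho, hn, fun i => by simp, fun i => ?_, fun i j hij => ?_,
    fun i j hij => ?_⟩, Set.eq_univ_of_forall fun v => ⟨e.symm v, ?_⟩⟩
  · rw [e.map_adj_iff, cycleGraph_adj_iff (by omega)]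
    left
    exact (Nat.mod_modEq _ _).trans ((Nat.mod_modEq i n).add_right 1).symm
  · have := e.injective hij
    simpa [Nat.ModEq] using this
  · rw [e.map_adj_iff, cycleGraph_adj_iff (by omega)] at hij
    refine hij.imp (fun h => ?_) fun h => ?_
    · exact (Nat.mod_modEq _ _).symm.trans (h.trans ((Nat.mod_modEq i n).add_right 1))
    · exact (Nat.mod_modEq _ _).symm.trans (h.trans ((Nat.mod_modEq j n).add_right 1))
  · simp [Nat.mod_eq_of_lt (e.symm v).2]

namespace IsInducedOddCycle

variable {R : SimpleGraph V} {n : ℕ} {f : ℕ → V}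

theorem bijective (hf : R.IsInducedOddCycle n f) (hrange : Set.range f = Set.univ) :
    Function.Bijective fun i : Fin n => f i := by
  refine ⟨fun i j hij => Fin.ext (hf.inj_of_lt hij (by omega) (by omega)), fun v => ?_⟩
  obtain ⟨i, rfl⟩ := (Set.range_eq_univ.1 hrange) v
  exact ⟨⟨i % n, Nat.mod_lt _ hf.pos⟩, hf.mod i⟩

theorem adj_iff (hf : R.IsInducedOddCycle n f) {i j : ℕ} :
    R.Adj (f i) (f j) ↔ j ≡ i + 1 [MOD n] ∨ i ≡ j + 1 [MOD n] := by
  refine ⟨hf.adj_only i j, ?_⟩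
  rintro (h | h)
  · rw [hf.eq_iff.2 h]
    exact hf.adj i
  · rw [hf.eq_iff.2 h]
    exact (hf.adj j).symm

theorem nonempty_iso (hf : R.IsInducedOddCycle n f) (hrange : Set.range f = Set.univ) :
    Nonempty (cycleGraph n ≃g R) :=
  ⟨⟨Equiv.ofBijective _ (hf.bijective hrange), fun {a b} => by
    have := hf.three_le
    rw [cycleGraph_adj_iff (by omega)]
    exact hf.adj_iff⟩⟩

theorem natCard_eq (hf : R.IsInducedOddCycle n f) (hrange : Set.range f = Set.univ) :
    Nat.card V = n := by
  rw [← Nat.card_eq_of_bijective _ (hf.bijective hrange), Nat.card_fin]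

/-- Every vertex is `f i` for some index `i` in any window of length `n`. -/
theorem exists_index (hf : R.IsInducedOddCycle n f) (hrange : Set.range f = Set.univ) (s : ℕ)
    (v : V) : ∃ i, s ≤ i ∧ i < s + n ∧ f i = v := by
  have hg := hf.shift s
  obtain ⟨j, rfl⟩ := (Set.range_eq_univ.1 hrange) v
  have h1 := hg.mod (j + n * s - s)
  have hle : s ≤ j + n * s := by
    have := Nat.le_mul_of_pos_left s hf.pos
    omega
  refine ⟨s + (j + n * s - s) % n, by omega, by have := Nat.mod_lt (j + n * s - s) hf.pos; omega,
    h1.trans ?_⟩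
  rw [show s + (j + n * s - s) = j + n * s by omega, hf.eq_iff]
  simp [Nat.ModEq]

theorem range_shift (hf : R.IsInducedOddCycle n f) (hrange : Set.range f = Set.univ) (s : ℕ) :
    Set.range (fun i => f (s + i)) = Set.univ := by
  refine Set.eq_univ_of_forall fun v => ?_
  obtain ⟨i, h1, -, h2⟩ := hf.exists_index hrange s v
  exact ⟨i - s, by simpa [Nat.add_sub_cancel' h1] using h2⟩

end IsInducedOddCycle

theorem IsMultisun.exists_cycle {G : SimpleGraph V} (h : G.IsMultisun) :
    ∃ n f, G.rim.IsInducedOddCycle n f ∧ Set.range f = Set.univ := by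
  obtain ⟨-, h3, ho, ⟨e⟩⟩ := h
  exact ⟨_, exists_isInducedOddCycle_of_iso h3 ho e⟩

theorem IsInducedOddCycle.isMultisun {G : SimpleGraph V} (hG : G.IsDiamondFree) {n : ℕ}
    {f : ℕ → V} (hf : G.rim.IsInducedOddCycle n f) (hrange : Set.range f = Set.univ) :
    G.IsMultisun := by
  have hc := hf.natCard_eq hrange
  refine ⟨hG, hc ▸ hf.three_le, hc ▸ hf.odd, ?_⟩
  rw [hc]
  exact hf.nonempty_iso hrange

theorem IsOddHole.exists_cycle {G : SimpleGraph V} (h : G.IsOddHole) :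
    G.rim = G ∧ ∃ n f, G.rim.IsInducedOddCycle n f ∧ Set.range f = Set.univ := by
  obtain ⟨n, h5, ho, ⟨e⟩⟩ := h
  obtain ⟨f, hf, hrange⟩ := exists_isInducedOddCycle_of_iso (by omega) ho e
  have hGr : G.rim = G := by
    ext u v
    rw [rim_adj_iff]
    refine ⟨fun h => h.1, fun huv => ⟨huv, ?_⟩⟩
    obtain ⟨a, rfl⟩ := (Set.range_eq_univ.1 hrange) u
    obtain ⟨b, rfl⟩ := (Set.range_eq_univ.1 hrange) v
    have key : ∀ i w, ¬ (G.Adj w (f i) ∧ G.Adj w (f (i + 1))) := by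
      rintro i w ⟨h1, h2⟩
      obtain ⟨j, rfl⟩ := (Set.range_eq_univ.1 hrange) w
      have hd : ∀ k, 0 < k → k < 5 → ¬ i ≡ i + k [MOD n] := by
        intro k hk hk5 hc
        have h3 := (Nat.modEq_iff_dvd' (by omega)).1 hc
        have := Nat.le_of_dvd (by omega) h3
        omega
      rcases hf.adj_only _ _ h1 with h1 | h1
      · rcases hf.adj_only _ _ h2 with h2 | h2
        · exact hd 1 (by omega) (by omega) (h1.trans h2.symm)
        · exact hd 3 (by omega) (by omega) (h1.trans (h2.add_right 1))
      · rcases hf.adj_only _ _ h2 with h2 | h2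
        · exact hd 1 (by omega) (by omega) ((Nat.ModEq.add_right_cancel' 1 h2).trans h1)
        · exact hd 1 (by omega) (by omega) (Nat.ModEq.add_right_cancel' 1 (h1.symm.trans h2))
    intro w hw
    rcases hf.adj_only _ _ huv with h | h
    · rw [hf.eq_iff.2 h] at hw
      exact key a w hw
    · rw [hf.eq_iff.2 h] at hw
      exact key b w hw.symm
  exact ⟨hGr, n, f, by rwa [hGr], hrange⟩

/-! ### Parities of rim paths -/

/-- `h 0, …, h k` is a path on the rim. -/
def IsRimPath (G : SimpleGraph V) (h : ℕ → V) (k : ℕ) : Prop :=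
  (∀ i < k, G.rim.Adj (h i) (h (i + 1))) ∧ ∀ i j, i ≤ k → j ≤ k → h i = h j → i = j

/-- The N-conditions for all sub-multisuns amount to these conditions on at most two inscribed
cliques. -/
structure HasPathParity (G : SimpleGraph V) : Prop where
  single : ∀ A ∈ G.inscribedCliques, ∀ h k, G.IsRimPath h k → 0 < k → h 0 ∈ A → h k ∈ A →
    (∀ i, 0 < i → i < k → h i ∉ A) → Odd k
  pair : ∀ A ∈ G.inscribedCliques, ∀ B ∈ G.inscribedCliques, A ≠ B → ∀ h k, G.IsRimPath h k →
    h 0 ∈ A → h 0 ∉ B → h k ∈ B → h k ∉ A → (∀ i, 0 < i → i < k → h i ∉ A ∧ h i ∉ B) → Even k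
  common : ∃ ξ : V, ∀ A ∈ G.inscribedCliques, ∀ B ∈ G.inscribedCliques, A ≠ B →
    (A : Set V) ∩ B = {ξ}

theorem removeCliques_adj {G : SimpleGraph V} {R : Set (Finset V)} {u v : V} :
    (G.removeCliques R).Adj u v ↔ G.Adj u v ∧ ∀ K ∈ R, ¬ (u ∈ K ∧ v ∈ K) := by
  simp only [removeCliques, deleteEdges_adj]
  refine and_congr_right fun _ => ?_
  simp

theorem removeCliques_empty (G : SimpleGraph V) : G.removeCliques ∅ = G := by
  ext u v
  simp [removeCliques_adj]

/-- Distinct maximal cliques share no edge, so the remaining ones stay complete. Every vertex keeps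
a rim edge, so no singleton becomes a maximal clique. -/
theorem isMaxClique_removeCliques [Finite V] {G : SimpleGraph V} (hG : G.IsDiamondFree)
    (hrim : ∀ u, ∃ v, G.rim.Adj u v) {R : Set (Finset V)} (hR : R ⊆ G.inscribedCliques)
    {K : Finset V} : (G.removeCliques R).IsMaxClique K ↔ G.IsMaxClique K ∧ K ∉ R := by
  have hle : ∀ s : Set V, (G.removeCliques R).IsClique s → G.IsClique s :=
    fun s hs => hs.mono fun u v huv => (removeCliques_adj.1 huv).1
  have hcl : ∀ L, G.IsMaxClique L → L ∉ R → (G.removeCliques R).IsClique (L : Set V) := by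
    intro L hL hLR x hx y hy hxy
    refine removeCliques_adj.2 ⟨hL.adj hx hy hxy, fun K hK ⟨hxK, hyK⟩ => hLR ?_⟩
    rwa [hL.eq_of_mem (hR hK).1 hG hx hy hxK hyK hxy]
  constructor
  · intro hK
    have h2 : ∃ u ∈ K, ∃ v ∈ K, u ≠ v := by
      obtain ⟨u, hu⟩ := hK.1
      by_contra hcon
      push Not at hcon
      obtain ⟨v, hv⟩ := hrim u
      have hadj : (G.removeCliques R).Adj u v := removeCliques_adj.2 ⟨(rim_adj_iff.1 hv).1,
        fun L hL ⟨huL, hvL⟩ => G.not_rim_adj_of_mem_inscribedCliques (hR hL) huL hvL hv⟩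
      have := hK.mem_of_forall_adj (w := v) fun x hx _ => by
        rw [← hcon u hu x hx]
        exact hadj.symm
      exact hadj.ne (hcon u hu v this)
    obtain ⟨u, hu, v, hv, huv⟩ := h2
    obtain ⟨L, hL, hKL⟩ := exists_isMaxClique hK.1 (hle _ hK.2.1)
    have hLR : L ∉ R := fun hc =>
      (removeCliques_adj.1 (hK.adj hu hv huv)).2 L hc ⟨hKL hu, hKL hv⟩
    have : L = K := (hK.2.2 (hcl L hL hLR) hKL).antisymm hKL
    exact this ▸ ⟨hL, hLR⟩
  · rintro ⟨hK, hKR⟩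
    exact ⟨hK.1, hcl K hK hKR, fun L hL hKL => hK.2.2 (hle _ hL) hKL⟩

theorem inscribedCliques_removeCliques [Finite V] {G : SimpleGraph V} (hG : G.IsDiamondFree)
    (hrim : ∀ u, ∃ v, G.rim.Adj u v) {R : Set (Finset V)} (hR : R ⊆ G.inscribedCliques) :
    (G.removeCliques R).inscribedCliques = G.inscribedCliques \ R := by
  ext K
  simp only [inscribedCliques, Set.mem_sdiff, Set.mem_ofPred_eq,
    isMaxClique_removeCliques hG hrim hR]
  tauto

theorem rim_removeCliques [Finite V] {G : SimpleGraph V} (hG : G.IsDiamondFree)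
    (hrim : ∀ u, ∃ v, G.rim.Adj u v) {R : Set (Finset V)} (hR : R ⊆ G.inscribedCliques) :
    (G.removeCliques R).rim = G.rim := by
  ext u v
  simp only [rim, isMaxClique_removeCliques hG hrim hR]
  refine and_congr_right fun huv => exists_congr fun K => ⟨fun h => ⟨h.1.1, h.2⟩, fun h =>
    ⟨⟨h.1, fun hK => (hR hK).2 ?_⟩, h.2⟩⟩
  rw [← Set.ncard_coe_finset, h.2, Set.ncard_pair huv]

theorem exists_walk_of_adj {R : SimpleGraph V} (h : ℕ → V) (k : ℕ)
    (hadj : ∀ i < k, R.Adj (h i) (h (i + 1))) :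
    ∃ p : R.Walk (h 0) (h k), p.support = (List.range (k + 1)).map h := by
  induction k with
  | zero => exact ⟨Walk.nil, by simp⟩
  | succ k ih =>
    obtain ⟨p, hp⟩ := ih fun i hi => hadj i (by omega)
    refine ⟨p.concat (hadj k (by omega)), ?_⟩
    rw [Walk.support_concat, hp, List.range_succ (n := k + 1), List.map_append]
    simp

theorem exists_isCliquePath {G H : SimpleGraph V} (hGH : H.rim = G.rim) {h : ℕ → V} {k : ℕ}
    (hp : G.IsRimPath h k) (hk : 0 < k) {A B : Finset V} (hA : h 0 ∈ A) (hB : h k ∈ B)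
    (hin : ∀ i, 0 < i → i < k → ∀ K ∈ H.inscribedCliques, h i ∉ K) :
    ∃ p : H.rim.Walk (h 0) (h k), H.IsCliquePath A B p ∧ p.support.length = k + 1 := by
  obtain ⟨p, hsupp⟩ := exists_walk_of_adj (R := H.rim) h k (hGH ▸ hp.1)
  refine ⟨p, ⟨?_, ?_, hA, hB, ?_⟩, by simp [hsupp]⟩
  · rw [Walk.isPath_def, hsupp]
    refine List.Nodup.map_on (fun i hi j hj hij => ?_) List.nodup_range
    rw [List.mem_range] at hi hj
    exact hp.2 i j (by omega) (by omega) hij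
  · intro he
    have := hp.2 0 k (by omega) le_rfl he
    omega
  · intro w hw hw0 hwk K hK
    rw [hsupp, List.mem_map] at hw
    obtain ⟨i, hi, rfl⟩ := hw
    rw [List.mem_range] at hi
    refine hin i ?_ ?_ K hK
    · rcases Nat.eq_zero_or_pos i with rfl | h
      · exact absurd rfl hw0
      · exact h
    · by_contra hc
      have : i = k := by omega
      exact hwk (this ▸ rfl)

theorem IsCliquePath.exists_isRimPath {G H : SimpleGraph V} (hGH : H.rim = G.rim) {A B : Finset V}
    {u v : V} {p : H.rim.Walk u v} (hp : H.IsCliquePath A B p) :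
    ∃ h k, G.IsRimPath h k ∧ 0 < k ∧ p.support.length = k + 1 ∧ h 0 = u ∧ h k = v ∧
      ∀ i, 0 < i → i < k → ∀ K ∈ H.inscribedCliques, h i ∉ K := by
  obtain ⟨hpath, huv, -, -, hin⟩ := hp
  have hinj : ∀ i j, i ≤ p.length → j ≤ p.length → p.getVert i = p.getVert j → i = j :=
    fun i j hi hj hij => hpath.getVert_injOn hi hj hij
  have hpos : 0 < p.length := by
    rw [Nat.pos_iff_ne_zero]
    exact fun h0 => huv (Walk.eq_of_length_eq_zero h0)
  refine ⟨p.getVert, p.length, ⟨fun i hi => ?_, hinj⟩, hpos, p.length_support, by simp, by simp,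
    fun i h0 hk => hin _ (p.getVert_mem_support i) (fun he => ?_) fun he => ?_⟩
  · rw [← hGH]
    exact p.adj_getVert_succ hi
  · have := hinj i 0 (by omega) (by omega) (by simpa using he)
    omega
  · have := hinj i p.length (by omega) le_rfl (by simpa using he)
    omega

theorem IsMultisun.exists_rim_adj {G : SimpleGraph V} (h : G.IsMultisun) (u : V) :
    ∃ v, G.rim.Adj u v := by
  obtain ⟨n, f, hf, hrange⟩ := h.exists_cycle
  obtain ⟨i, rfl⟩ := (Set.range_eq_univ.1 hrange) u
  exact ⟨_, hf.adj i⟩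

/-- Apply the N-conditions to the graph in which only `A`, or only `A` and `B`, remain inscribed;
inner vertices of a path then need to avoid these cliques only. -/
theorem IsSunoid.hasPathParity [Finite V] {G : SimpleGraph V} (h : G.IsSunoid) :
    G.HasPathParity := by
  obtain ⟨hM, -, hN, hsub⟩ := h
  have hrim := hM.exists_rim_adj
  have key : ∀ L ⊆ G.inscribedCliques, L.Nonempty → ∃ H : SimpleGraph V,
      H.rim = G.rim ∧ H.inscribedCliques = L ∧ H.NConditions := by
    intro L hL hne
    have hR : G.inscribedCliques \ L ⊂ G.inscribedCliques := by
      obtain ⟨A, hA⟩ := hne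
      exact ⟨Set.sdiff_subset, fun hc => (hc (hL hA)).2 hA⟩
    exact ⟨G.removeCliques (G.inscribedCliques \ L), rim_removeCliques hM.1 hrim hR.1,
      by rw [inscribedCliques_removeCliques hM.1 hrim hR.1, Set.sdiff_sdiff_cancel_left hL],
      hsub _ ⟨_, hR, rfl⟩⟩
  refine ⟨fun A hA h k hp hk h0 hkA hin => ?_, fun A hA B hB hAB h k hp h0A h0B hkB hkA hin => ?_,
    hN.2.2.1.imp fun _ h => h.1⟩
  · obtain ⟨H, hr, hi, hH⟩ := key {A} (by simpa using hA) (by simp)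
    obtain ⟨p, hp, hlen⟩ := exists_isCliquePath hr hp hk h0 hkA
      (fun i h1 h2 K hK => by rw [hi] at hK; rw [Set.mem_singleton_iff.1 hK]; exact hin i h1 h2)
    have := (hH.1 A (by simp [hi]) _ _ p hp).1
    rw [hlen, Nat.even_add_one, Nat.not_even_iff_odd] at this
    exact this
  · obtain ⟨H, hr, hi, hH⟩ := key {A, B} (by simp [Set.insert_subset_iff, hA, hB]) (by simp)
    have hk : 0 < k := by
      rcases Nat.eq_zero_or_pos k with rfl | h
      · exact absurd hkB h0B
      · exact h
    obtain ⟨p, hp, hlen⟩ := exists_isCliquePath hr hp hk h0A hkB (fun i h1 h2 K hK => by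
      rw [hi] at hK
      rcases hK with rfl | hK
      · exact (hin i h1 h2).1
      · rw [Set.mem_singleton_iff.1 hK]
        exact (hin i h1 h2).2)
    have := hH.2.2.2 A (by simp [hi]) B (by simp [hi]) hAB _ _ p hp
      (fun K hK h0K => by
        rw [hi] at hK
        rcases hK with rfl | hK
        · rfl
        · rw [Set.mem_singleton_iff.1 hK] at h0K
          exact absurd h0K h0B)
      (fun K hK hkK => by
        rw [hi] at hK
        rcases hK with rfl | hK
        · exact absurd hkK hkA
        · exact hK)
    rw [hlen] at this
    rwa [Nat.odd_add_one, Nat.not_odd_iff_even] at this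

end SimpleGraph

namespace SimpleGraph

variable {V : Type*}

/-! ### Minimal odd rims have the path parities -/

theorem exists_last {P : ℕ → Prop} {s p : ℕ} (hsp : s < p) (hs : P s) :
    ∃ q, s ≤ q ∧ q < p ∧ P q ∧ ∀ i, q < i → i < p → ¬ P i := by
  classical
  refine ⟨Nat.findGreatest P (p - 1), Nat.le_findGreatest (by omega) hs, ?_,
    Nat.findGreatest_spec (m := s) (by omega) hs, fun i h1 h2 =>
      Nat.findGreatest_is_greatest h1 (by omega)⟩
  have := Nat.findGreatest_le (P := P) (p - 1)
  omega

theorem exists_next {P : ℕ → Prop} {s p : ℕ} (hsp : s < p) (hp : P p) :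
    ∃ q, s < q ∧ q ≤ p ∧ P q ∧ ∀ i, s < i → i < q → ¬ P i := by
  classical
  have hex : ∃ q, s < q ∧ P q := ⟨p, hsp, hp⟩
  exact ⟨Nat.find hex, (Nat.find_spec hex).1, Nat.find_min' hex ⟨hsp, hp⟩, (Nat.find_spec hex).2,
    fun i h1 h2 h3 => Nat.find_min hex h2 ⟨h1, h3⟩⟩

theorem count_eq_of_forall_not {P : ℕ → Prop} [DecidablePred P] {q p : ℕ} (hqp : q ≤ p)
    (h : ∀ i, q ≤ i → i < p → ¬ P i) : Nat.count P p = Nat.count P q := by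
  induction p, hqp using Nat.le_induction with
  | base => rfl
  | succ p hqp ih =>
    rw [Nat.count_succ, if_neg (h p hqp (by omega)), ih fun i h1 h2 => h i h1 (by omega),
      add_zero]

/-- All rim paths between consecutive vertices of `A` have odd length. -/
def HasOddGaps (G : SimpleGraph V) (A : Finset V) : Prop :=
  ∀ h k, G.IsRimPath h k → 0 < k → h 0 ∈ A → h k ∈ A → (∀ i, 0 < i → i < k → h i ∉ A) → Odd k

/-- `h` is a rim path of length `k` from `A` to `B` with no inner vertex in `A` or `B`. -/
def IsTransition (G : SimpleGraph V) (A B : Finset V) (h : ℕ → V) (k : ℕ) : Prop :=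
  G.IsRimPath h k ∧ h 0 ∈ A ∧ h k ∈ B ∧ ∀ i, 0 < i → i < k → h i ∉ A ∧ h i ∉ B

theorem three_le_card_of_mem_inscribedCliques {G : SimpleGraph V}
    (hrim : ∀ u, ∃ v, G.rim.Adj u v) {A : Finset V} (hA : A ∈ G.inscribedCliques) :
    3 ≤ A.card := by
  have h1 := hA.1.1.card_pos
  have h2 := hA.2
  by_contra h3
  obtain ⟨u, rfl⟩ := Finset.card_eq_one.1 (show A.card = 1 by omega)
  obtain ⟨v, hv⟩ := hrim u
  have hadj := (rim_adj_iff.1 hv).1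
  have := hA.1.mem_of_forall_adj (w := v) fun x hx _ => by
    rw [Finset.mem_singleton.1 hx]
    exact hadj.symm
  exact hadj.ne (Finset.mem_singleton.1 this).symm

theorem exists_mem_of_three_le_card {A : Finset V} (hA : 3 ≤ A.card) (x y : V) :
    ∃ z ∈ A, z ≠ x ∧ z ≠ y := by
  classical
  by_contra hcon
  push Not at hcon
  have hsub : A ⊆ {x, y} := fun z hz => by
    by_cases hzx : z = x
    · simp [hzx]
    · simp [hcon z hz hzx]
  have := Finset.card_le_card hsub
  have := Finset.card_le_two (a := x) (b := y)
  omega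

/-! ### Counting the vertices of inscribed cliques around an odd rim -/

namespace IsInducedOddCycle

variable {G : SimpleGraph V} {n : ℕ} {f : ℕ → V}

theorem isRimPath (hf : G.rim.IsInducedOddCycle n f) {k : ℕ} (hk : k < n) : G.IsRimPath f k :=
  ⟨fun i _ => hf.adj i, fun i j hi hj hij => hf.inj_of_lt hij (by omega) (by omega)⟩

theorem isRimPath_reverse (hf : G.rim.IsInducedOddCycle n f) {b k : ℕ} (hk : k < n) (hkb : k ≤ b) :
    G.IsRimPath (fun i => f (b - i)) k := by
  refine ⟨fun i hi => ?_, fun i j hi hj hij => ?_⟩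
  · have := (hf.adj (b - (i + 1))).symm
    rwa [show b - (i + 1) + 1 = b - i by omega] at this
  · have := hf.inj_of_lt hij (by omega) (by omega)
    omega

theorem count_eq_card [DecidableEq V] (hf : G.rim.IsInducedOddCycle n f)
    (hrange : Set.range f = Set.univ) (A : Finset V) :
    Nat.count (fun i => f i ∈ A) n = A.card := by
  rw [Nat.count_eq_card_filter_range]
  refine Finset.card_bij (fun i _ => f i) (fun i hi => (Finset.mem_filter.1 hi).2)
    (fun i hi j hj hij => ?_) fun v hv => ?_
  · have := Finset.mem_range.1 (Finset.mem_filter.1 hi).1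
    have := Finset.mem_range.1 (Finset.mem_filter.1 hj).1
    exact hf.inj_of_lt hij (by omega) (by omega)
  · obtain ⟨i, -, hi, rfl⟩ := hf.exists_index hrange 0 v
    exact ⟨i, by simpa [hv] using hi, rfl⟩

theorem odd_sub_of_gap (hf : G.rim.IsInducedOddCycle n f) {A : Finset V} (hA : G.HasOddGaps A)
    {q p : ℕ} (hqp : q < p) (hpn : p < q + n) (hq : f q ∈ A) (hp : f p ∈ A)
    (hno : ∀ i, q < i → i < p → f i ∉ A) : Odd (p - q) :=
  hA (fun i => f (q + i)) (p - q) ((hf.shift q).isRimPath (by omega)) (by omega) hq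
    (by rwa [Nat.add_sub_cancel' hqp.le]) fun i h1 h2 => hno _ (by omega) (by omega)

/-- From one vertex of `A` to the next, the count grows by one and the position by an odd number. -/
theorem even_count_add [DecidableEq V] (hf : G.rim.IsInducedOddCycle n f) {A : Finset V}
    (hA : G.HasOddGaps A) (h0 : f 0 ∈ A) {p : ℕ} (hpn : p < n) (hp : f p ∈ A) :
    Even (Nat.count (fun i => f i ∈ A) p + p) := by
  induction p using Nat.strong_induction_on with
  | _ p ih =>
    rcases Nat.eq_zero_or_pos p with rfl | hpos
    · simp
    obtain ⟨q, -, hqp, hq, hno⟩ := exists_last (P := fun i => f i ∈ A) hpos h0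
    have h1 := ih q hqp (by omega) hq
    have h2 := hf.odd_sub_of_gap hA hqp (by omega) hq hp hno
    rw [count_eq_of_forall_not (q := q + 1) (by omega) fun i hi => hno i (by omega),
      Nat.count_succ, if_pos hq]
    grind

/-- The rim length, which is odd, is a sum of `A.card` odd gaps. -/
theorem odd_card (hf : G.rim.IsInducedOddCycle n f) (hrange : Set.range f = Set.univ)
    {A : Finset V} (hA : G.HasOddGaps A) (hA3 : 3 ≤ A.card) : Odd A.card := by
  classical
  obtain ⟨a, ha⟩ := Finset.card_pos.1 (show 0 < A.card by omega)
  obtain ⟨s, rfl⟩ := (Set.range_eq_univ.1 hrange) a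
  have hg := hf.shift s
  have hgr := hf.range_shift hrange s
  set g := fun i => f (s + i) with hgdef
  have h0 : g 0 ∈ A := ha
  obtain ⟨b, hb, hb0, -⟩ := exists_mem_of_three_le_card hA3 (g 0) (g 0)
  obtain ⟨i, -, hin, rfl⟩ := hg.exists_index hgr 0 b
  have hi0 : i ≠ 0 := by
    rintro rfl
    exact hb0 rfl
  obtain ⟨q, hiq, hqn, hq, hno⟩ := exists_last (P := fun i => g i ∈ A) (show i < n by omega) hb
  have hgn : g n ∈ A := by
    have := hg.periodic 0
    rw [zero_add] at this
    rwa [this]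
  have h1 := hg.even_count_add hA h0 hqn hq
  have h2 := hg.odd_sub_of_gap hA hqn (by omega) hq hgn hno
  rw [← hg.count_eq_card hgr, count_eq_of_forall_not (q := q + 1) (by omega)
    fun i hi => hno i (by omega), Nat.count_succ, if_pos hq]
  have := hg.odd
  grind

/-- There is a vertex of `A` between two consecutive vertices of `B`. -/
theorem exists_isolated (hf : G.rim.IsInducedOddCycle n f)
    (hrange : Set.range f = Set.univ) {A B : Finset V} (hA : G.HasOddGaps A) (hB : G.HasOddGaps B)
    (hA3 : 3 ≤ A.card) (hB3 : 3 ≤ B.card) (hAB : Disjoint A B) (h0 : f 0 ∈ B)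
    (hQ : ∀ h₁ k₁ h₂ k₂, G.IsTransition A B h₁ k₁ → G.IsTransition A B h₂ k₂ → h₁ 0 ≠ h₂ 0 →
      h₁ k₁ ≠ h₂ k₂ → (Even k₁ ↔ Even k₂)) :
    ∃ q s p, q < s ∧ s < p ∧ p ≤ n ∧ p < q + n ∧ f q ∈ B ∧ f s ∈ A ∧ f p ∈ B ∧
      (∀ i, q < i → i < p → f i ∉ B) ∧ (∀ i, q < i → i < p → i ≠ s → f i ∉ A) := by
  classical
  have hdisj : ∀ {v}, v ∈ A → v ∈ B → False := fun ha hb => Finset.disjoint_left.1 hAB ha hb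
  -- Since `A.card` is odd, some gap of `B` contains an odd number of vertices of `A`.
  obtain ⟨q, p, hqp, hpn, hq, hp, hno, hodd⟩ : ∃ q p, q < p ∧ p ≤ n ∧ f q ∈ B ∧ f p ∈ B ∧
      (∀ i, q < i → i < p → f i ∉ B) ∧
      Odd (Nat.count (fun i => f i ∈ A) p + Nat.count (fun i => f i ∈ A) q) := by
    by_contra hcon
    have heven : ∀ p ≤ n, f p ∈ B → Even (Nat.count (fun i => f i ∈ A) p) := by
      intro p
      induction p using Nat.strong_induction_on with
      | _ p ih =>
        intro hpn hp
        rcases Nat.eq_zero_or_pos p with rfl | hpos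
        · simp
        obtain ⟨q, -, hqp, hq, hno⟩ := exists_last (P := fun i => f i ∈ B) hpos h0
        have h1 := ih q hqp (by omega) hq
        by_contra h2
        exact hcon ⟨q, p, hqp, hpn, hq, hp, hno, by grind⟩
    have h1 := heven n le_rfl (by
      have := hf.periodic 0
      rw [zero_add] at this
      rwa [this])
    rw [hf.count_eq_card hrange] at h1
    exact (Nat.not_odd_iff_even.2 h1) (hf.odd_card hrange hA hA3)
  have hpqn : p < q + n := by
    by_contra hc
    obtain ⟨b, hb, hb0, -⟩ := exists_mem_of_three_le_card hB3 (f 0) (f 0)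
    obtain ⟨i, -, hin, rfl⟩ := hf.exists_index hrange 0 b
    have hi0 : i ≠ 0 := by
      rintro rfl
      exact hb0 rfl
    exact hno i (by omega) (by omega) hb
  obtain ⟨x, hqx, hxp, hx⟩ : ∃ x, q < x ∧ x < p ∧ f x ∈ A := by
    by_contra hcon
    push Not at hcon
    rw [count_eq_of_forall_not hqp.le fun i h1 h2 h3 => ?_] at hodd
    · exact (Nat.not_odd_iff_even.2 (Even.add_self _)) hodd
    · rcases h1.eq_or_lt with rfl | h1
      · exact hdisj h3 hq
      · exact hcon i h1 h2 h3
  obtain ⟨s, hqs, hsx, hs, hsno⟩ := exists_next (P := fun i => f i ∈ A) hqx hx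
  obtain ⟨t, hxt, htp, ht, htno⟩ := exists_last (P := fun i => f i ∈ A) hxp hx
  -- If the first and last such vertices differ, they are an even distance apart, being separated by
  -- an even number of odd gaps. The transitions to the two ends have equal parity, so the gap of
  -- `B` would be even.
  have hst : s = t := by
    by_contra hne
    have hQst := hQ (fun i => f (s - i)) (s - q) (fun i => f (t + i)) (p - t)
      ⟨hf.isRimPath_reverse (by omega) (by omega), hs, by
        dsimp only
        rwa [show s - (s - q) = q by omega], fun i h1 h2 =>
          ⟨hsno _ (by omega) (by omega), hno _ (by omega) (by omega)⟩⟩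
      ⟨(hf.shift t).isRimPath (by omega), ht, by dsimp only; rwa [show t + (p - t) = p by omega],
        fun i h1 h2 => ⟨htno _ (by omega) (by omega), hno _ (by omega) (by omega)⟩⟩
      (fun he => hne (hf.inj_of_lt he (by omega) (by omega)))
      (fun he => by
        rw [show s - (s - q) = q by omega, show t + (p - t) = p by omega] at he
        have := hf.inj_of_lt he (by omega) (by omega)
        omega)
    have h1 := (hf.shift s).even_count_add hA hs (p := t - s) (by omega)
      (by rwa [show s + (t - s) = t by omega])
    have h2 : Nat.count (fun i => f i ∈ A) t = Nat.count (fun i => f i ∈ A) s +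
        Nat.count (fun i => f (s + i) ∈ A) (t - s) := by
      rw [← Nat.count_add, show s + (t - s) = t by omega]
    have h3 : Nat.count (fun i => f i ∈ A) p = Nat.count (fun i => f i ∈ A) t + 1 := by
      rw [count_eq_of_forall_not (q := t + 1) (by omega) fun i hi => htno i (by omega),
        Nat.count_succ, if_pos ht]
    have h4 : Nat.count (fun i => f i ∈ A) s = Nat.count (fun i => f i ∈ A) q :=
      count_eq_of_forall_not hqs.le fun i h1 h2 h3 => by
        rcases h1.eq_or_lt with rfl | h1
        · exact hdisj h3 hq
        · exact hsno i h1 h2 h3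
    have h5 := hf.odd_sub_of_gap hB hqp hpqn hq hp hno
    grind
  subst hst
  exact ⟨q, s, p, hqs, htp, hpn, hpqn, hq, hs, hp, hno, fun i h1 h2 h3 => by
    rcases lt_or_gt_of_ne h3 with h | h
    · exact hsno i h1 h
    · exact htno i h h2⟩

/-- The isolated vertex of `A` from `exists_isolated` splits an odd gap of `B` into two transitions
of opposite parities. The rest of the rim contains further vertices of both cliques, hence a
transition with new endpoints, whose parity would agree with both. -/
theorem not_disjoint_of_transitions (hf : G.rim.IsInducedOddCycle n f)
    (hrange : Set.range f = Set.univ) {A B : Finset V} (hA : G.HasOddGaps A) (hB : G.HasOddGaps B)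
    (hA3 : 3 ≤ A.card) (hB3 : 3 ≤ B.card)
    (hQ : ∀ h₁ k₁ h₂ k₂, G.IsTransition A B h₁ k₁ → G.IsTransition A B h₂ k₂ → h₁ 0 ≠ h₂ 0 →
      h₁ k₁ ≠ h₂ k₂ → (Even k₁ ↔ Even k₂)) : ¬ Disjoint A B := by
  classical
  intro hAB
  have hdisj : ∀ {v}, v ∈ A → v ∈ B → False := fun ha hb => Finset.disjoint_left.1 hAB ha hb
  obtain ⟨b, hb⟩ := Finset.card_pos.1 (show 0 < B.card by omega)
  obtain ⟨r, rfl⟩ := (Set.range_eq_univ.1 hrange) b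
  obtain ⟨q, s, p, hqs, hsp, hpn, hpqn, hq, hs, hp, hnoB, hnoA⟩ :=
    (hf.shift r).exists_isolated (hf.range_shift hrange r) hA hB hA3 hB3 hAB hb hQ
  have hf' := hf.shift r
  have hg := hf'.shift s
  have hgr := hf'.range_shift (hf.range_shift hrange r) s
  set f' := fun i => f (r + i)
  have hoddB := hf'.odd_sub_of_gap hB (hqs.trans hsp) hpqn hq hp hnoB
  set g := fun i => f' (s + i) with hgdef
  have hwrap : ∀ i, s ≤ n + i → g (n - s + i) = f' i := by
    intro i hi
    rw [hgdef]
    dsimp only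
    rw [show s + (n - s + i) = i + n by omega, hf'.periodic]
  obtain ⟨k, hk, hk0⟩ : ∃ k, k = p - s ∧ 0 < k := ⟨_, rfl, by omega⟩
  obtain ⟨l, hl, hl0⟩ : ∃ l, l = s - q ∧ 0 < l := ⟨_, rfl, by omega⟩
  have hg0 : g 0 ∈ A := hs
  have hgk : g k ∈ B := by
    rw [hgdef, hk]
    dsimp only
    rwa [show s + (p - s) = p by omega]
  have hgn : g n = g 0 := by
    have := hg.periodic 0
    rwa [zero_add] at this
  have hgl : g (n - l) ∈ B := by
    rw [show n - l = n - s + q by omega, hwrap q (by omega)]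
    exact hq
  have hlow : ∀ i, 0 < i → i < k → g i ∉ A ∧ g i ∉ B := fun i h1 h2 =>
    ⟨hnoA _ (by omega) (by omega) (by omega), hnoB _ (by omega) (by omega)⟩
  have hhigh : ∀ i, n - l < i → i < n → g i ∉ A ∧ g i ∉ B := by
    intro i h1 h2
    rw [show i = n - s + (i - (n - s)) by omega, hwrap _ (by omega)]
    exact ⟨hnoA _ (by omega) (by omega) (by omega), hnoB _ (by omega) (by omega)⟩
  have hmid : ∀ i, i < n → (g i ∈ A ∧ g i ≠ g 0 ∨ g i ∈ B ∧ g i ≠ g k ∧ g i ≠ g (n - l)) →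
      k < i ∧ i < n - l := by
    intro i hi h
    have h0 : i ≠ 0 := by
      rintro rfl
      rcases h with h | h
      · exact h.2 rfl
      · exact hdisj hg0 h.1
    have h1 : i ≠ k := by
      rintro rfl
      rcases h with h | h
      · exact hdisj h.1 hgk
      · exact h.2.1 rfl
    have h2 : i ≠ n - l := by
      rintro rfl
      rcases h with h | h
      · exact hdisj h.1 hgl
      · exact h.2.2 rfl
    constructor
    · by_contra hc
      have := hlow i (by omega) (by omega)
      tauto
    · by_contra hc
      have := hhigh i (by omega) hi
      tauto
  have hT1 : G.IsTransition A B g k := ⟨hg.isRimPath (by omega), hg0, hgk, hlow⟩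
  have hT2 : G.IsTransition A B (fun i => g (n - i)) l :=
    ⟨hg.isRimPath_reverse (by omega) (by omega), by simpa [hgn] using hg0, hgl,
      fun i h1 h2 => hhigh _ (by omega) (by omega)⟩
  -- A transition strictly inside the remaining arc can be compared with both transitions at `g 0`,
  -- whose lengths `k` and `l` have odd sum.
  have hinner : ∀ h m i j, G.IsTransition A B h m → h 0 = g i → h m = g j → k < i → i < n - l →
      k < j → j < n - l → False := by
    intro h m i j hT hi hj h1 h2 h3 h4
    have hne : ∀ x y, x < n → y < n → x ≠ y → g x ≠ g y := fun x y hx hy hxy he =>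
      hxy (hg.inj_of_lt he (by omega) (by omega))
    have e1 := hQ _ _ _ _ hT1 hT (by rw [hi]; exact hne _ _ (by omega) (by omega) (by omega))
      (by rw [hj]; exact hne _ _ (by omega) (by omega) (by omega))
    have e2 := hQ _ _ _ _ hT2 hT
      (by simp only [Nat.sub_zero, hgn]; rw [hi]; exact hne _ _ (by omega) (by omega) (by omega))
      (by rw [hj]; exact hne _ _ (by omega) (by omega) (by omega))
    have : p - q = k + l := by omega
    rw [this] at hoddB
    grind
  obtain ⟨a, ha, ha0, -⟩ := exists_mem_of_three_le_card hA3 (g 0) (g 0)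
  obtain ⟨i, -, hin, rfl⟩ := hg.exists_index hgr 0 a
  obtain ⟨b, hb', hbk, hbl⟩ := exists_mem_of_three_le_card hB3 (g k) (g (n - l))
  obtain ⟨j, -, hjn, rfl⟩ := hg.exists_index hgr 0 b
  obtain ⟨hi1, hi2⟩ := hmid i (by omega) (Or.inl ⟨ha, ha0⟩)
  obtain ⟨hj1, hj2⟩ := hmid j (by omega) (Or.inr ⟨hb', hbk, hbl⟩)
  have hij : i ≠ j := by
    rintro rfl
    exact hdisj ha hb'
  rcases lt_or_gt_of_ne hij with hlt | hlt
  · obtain ⟨x, hix, hxj, hx, hxno⟩ := exists_last (P := fun i => g i ∈ A) hlt ha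
    obtain ⟨y, hxy, hyj, hy, hyno⟩ := exists_next (P := fun i => g i ∈ B) hxj hb'
    exact hinner (fun i => g (x + i)) (y - x) x y
      ⟨(hg.shift x).isRimPath (by omega), hx, by dsimp only; rwa [show x + (y - x) = y by omega],
        fun i h1 h2 => ⟨hxno _ (by omega) (by omega), hyno _ (by omega) (by omega)⟩⟩ rfl
      (by rw [show x + (y - x) = y by omega]) (by omega) (by omega) (by omega) (by omega)
  · obtain ⟨x, hjx, hxi, hx, hxno⟩ := exists_last (P := fun i => g i ∈ B) hlt hb'
    obtain ⟨y, hxy, hyi, hy, hyno⟩ := exists_next (P := fun i => g i ∈ A) hxi ha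
    exact hinner (fun i => g (y - i)) (y - x) y x
      ⟨hg.isRimPath_reverse (by omega) (by omega), hy, by dsimp only; rwa [show y - (y - x) = x by omega],
        fun i h1 h2 => ⟨hyno _ (by omega) (by omega), hxno _ (by omega) (by omega)⟩⟩ rfl
      (by rw [show y - (y - x) = x by omega]) (by omega) (by omega) (by omega) (by omega)

end IsInducedOddCycle

end SimpleGraph

/-! ### Path parities from colourings of proper induced subgraphs -/

namespace SimpleGraph

variable {V : Type*}

/-- A set that meets an inscribed clique in at most two vertices carries a 2-colouring of its
rim. -/
theorem IsMinimalOddRim.exists_coloring {G : SimpleGraph V} (h : G.IsMinimalOddRim Set.univ)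
    {A : Finset V} (hA3 : 3 ≤ A.card) {T : Set V} {x y : V}
    (hT : ∀ w ∈ T, w ∈ A → w = x ∨ w = y) :
    ∃ c : V → Bool, ∀ u v, (G.rimOn T).Adj u v → c u ≠ c v := by
  refine h.2 T ⟨Set.subset_univ T, fun hc => ?_⟩
  obtain ⟨z, hz, hzx, hzy⟩ := exists_mem_of_three_le_card hA3 x y
  rcases hT z (hc trivial) hz with h | h
  · exact hzx h
  · exact hzy h

theorem IsRimPath.color_eq_iff {G : SimpleGraph V} {h : ℕ → V} {k : ℕ} (hp : G.IsRimPath h k)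
    {T : Set V} (hT : ∀ i ≤ k, h i ∈ T) {c : V → Bool}
    (hc : ∀ u v, (G.rimOn T).Adj u v → c u ≠ c v) : c (h k) = c (h 0) ↔ Even k :=
  alternating_eq_iff (b := fun i => c (h i)) fun i hi =>
    hc _ _ (rimOn_of_rim (hT i (by omega)) (hT (i + 1) (by omega)) (hp.1 i hi))

namespace IsMinimalOddRim

variable {G : SimpleGraph V}

theorem exists_cycle_univ (h : G.IsMinimalOddRim Set.univ) :
    ∃ n f, G.rim.IsInducedOddCycle n f ∧ Set.range f = Set.univ := by
  have := h.exists_cycle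
  rwa [rimOn_univ] at this

theorem exists_rim_adj (h : G.IsMinimalOddRim Set.univ) (u : V) : ∃ v, G.rim.Adj u v := by
  obtain ⟨n, f, hf, hrange⟩ := h.exists_cycle_univ
  obtain ⟨i, rfl⟩ := (Set.range_eq_univ.1 hrange) u
  exact ⟨_, hf.adj i⟩

/-- On the vertices of the path, the edge of `A` between its ends is a rim edge. The path together
with this edge is a closed walk in a bipartite graph. -/
theorem hasOddGaps (h : G.IsMinimalOddRim Set.univ) (hG : G.IsDiamondFree) {A : Finset V}
    (hA : A ∈ G.inscribedCliques) : G.HasOddGaps A := by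
  intro f k hp hk h0 hkA hin
  have hT : ∀ w ∈ f '' Set.Iic k, w ∈ A → w = f 0 ∨ w = f k := by
    rintro _ ⟨i, hi, rfl⟩ hiA
    rw [Set.mem_Iic] at hi
    by_contra hcon
    rw [not_or] at hcon
    refine hin i (Nat.pos_of_ne_zero fun h => hcon.1 (h ▸ rfl))
      (lt_of_le_of_ne hi fun h => hcon.2 (h ▸ rfl)) hiA
  have hmem : ∀ i ≤ k, f i ∈ f '' Set.Iic k := fun i hi => ⟨i, hi, rfl⟩
  obtain ⟨c, hc⟩ := h.exists_coloring
    (three_le_card_of_mem_inscribedCliques h.exists_rim_adj hA) hT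
  have hne : f 0 ≠ f k := fun he => hk.ne (hp.2 0 k (by omega) le_rfl he)
  have h1 := hc _ _ (hA.1.rimOn_adj hG (hmem 0 (by omega)) (hmem k le_rfl) h0 hkA hne hT)
  rw [← Nat.not_even_iff_odd, ← hp.color_eq_iff hmem hc]
  exact fun h => h1 h.symm

/-- On the union of the two paths, each clique has exactly two vertices and so contributes a rim
edge. The closed walk formed by both paths and these edges has length `k₁ + k₂ + 2`. The paths may
overlap, since only colours are compared. -/
theorem even_iff_of_transitions (h : G.IsMinimalOddRim Set.univ) (hG : G.IsDiamondFree)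
    {A B : Finset V} (hA : A ∈ G.inscribedCliques) (hB : B ∈ G.inscribedCliques)
    (hAB : Disjoint A B) {h₁ h₂ : ℕ → V} {k₁ k₂ : ℕ} (hT₁ : G.IsTransition A B h₁ k₁)
    (hT₂ : G.IsTransition A B h₂ k₂) (h0 : h₁ 0 ≠ h₂ 0) (hk : h₁ k₁ ≠ h₂ k₂) :
    Even k₁ ↔ Even k₂ := by
  have hdisj : ∀ {v}, v ∈ A → v ∈ B → False := fun ha hb => Finset.disjoint_left.1 hAB ha hb
  have key : ∀ {f : ℕ → V} {k i : ℕ}, G.IsTransition A B f k → i ≤ k →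
      (f i ∈ A → f i = f 0) ∧ (f i ∈ B → f i = f k) := by
    intro f k i hT hi
    obtain ⟨-, hf0, hfk, hin⟩ := hT
    constructor
    · intro hiA
      by_contra hcon
      rcases Nat.eq_zero_or_pos i with rfl | hpos
      · exact hcon rfl
      rcases hi.eq_or_lt with rfl | hlt
      · exact hdisj hiA hfk
      · exact (hin i hpos hlt).1 hiA
    · intro hiB
      by_contra hcon
      rcases hi.eq_or_lt with rfl | hlt
      · exact hcon rfl
      rcases Nat.eq_zero_or_pos i with rfl | hpos
      · exact hdisj hf0 hiB
      · exact (hin i hpos hlt).2 hiB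
  set T := h₁ '' Set.Iic k₁ ∪ h₂ '' Set.Iic k₂
  have hm₁ : ∀ i ≤ k₁, h₁ i ∈ T := fun i hi => Or.inl ⟨i, hi, rfl⟩
  have hm₂ : ∀ i ≤ k₂, h₂ i ∈ T := fun i hi => Or.inr ⟨i, hi, rfl⟩
  have hTA : ∀ w ∈ T, w ∈ A → w = h₁ 0 ∨ w = h₂ 0 := by
    rintro _ (⟨i, hi, rfl⟩ | ⟨i, hi, rfl⟩) hw
    · exact Or.inl ((key hT₁ hi).1 hw)
    · exact Or.inr ((key hT₂ hi).1 hw)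
  have hTB : ∀ w ∈ T, w ∈ B → w = h₁ k₁ ∨ w = h₂ k₂ := by
    rintro _ (⟨i, hi, rfl⟩ | ⟨i, hi, rfl⟩) hw
    · exact Or.inl ((key hT₁ hi).2 hw)
    · exact Or.inr ((key hT₂ hi).2 hw)
  obtain ⟨c, hc⟩ := h.exists_coloring
    (three_le_card_of_mem_inscribedCliques h.exists_rim_adj hA) hTA
  have e1 := hc _ _ (hA.1.rimOn_adj hG (hm₁ 0 (by omega)) (hm₂ 0 (by omega)) hT₁.2.1 hT₂.2.1 h0 hTA)
  have e2 := hc _ _ (hB.1.rimOn_adj hG (hm₁ k₁ le_rfl) (hm₂ k₂ le_rfl) hT₁.2.2.1 hT₂.2.2.1 hk hTB)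
  rw [← hT₁.1.color_eq_iff hm₁ hc, ← hT₂.1.color_eq_iff hm₂ hc]
  revert e1 e2
  generalize c (h₁ 0) = p
  generalize c (h₂ 0) = q
  generalize c (h₁ k₁) = r
  generalize c (h₂ k₂) = s
  revert p q r s
  decide

theorem exists_common (h : G.IsMinimalOddRim Set.univ) (hG : G.IsDiamondFree) :
    ∃ ξ : V, ∀ A ∈ G.inscribedCliques, ∀ B ∈ G.inscribedCliques, A ≠ B →
      (A : Set V) ∩ B = {ξ} := by
  obtain ⟨n, f, hf, hrange⟩ := h.exists_cycle_univ
  have hmeet : ∀ A ∈ G.inscribedCliques, ∀ B ∈ G.inscribedCliques, ∃ x, x ∈ A ∧ x ∈ B := by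
    intro A hA B hB
    by_contra hcon
    have hAB : Disjoint A B := Finset.disjoint_left.2 fun x hx hx' => hcon ⟨x, hx, hx'⟩
    exact hf.not_disjoint_of_transitions hrange (h.hasOddGaps hG hA) (h.hasOddGaps hG hB)
      (three_le_card_of_mem_inscribedCliques h.exists_rim_adj hA)
      (three_le_card_of_mem_inscribedCliques h.exists_rim_adj hB)
      (fun h₁ k₁ h₂ k₂ => h.even_iff_of_transitions hG hA hB hAB) hAB
  have huniq : ∀ A ∈ G.inscribedCliques, ∀ B ∈ G.inscribedCliques, A ≠ B → ∀ x y, x ∈ A → x ∈ B →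
      y ∈ A → y ∈ B → x = y := by
    intro A hA B hB hAB x y hxA hxB hyA hyB
    by_contra hne
    exact hAB (hA.1.eq_of_mem hB.1 hG hxA hyA hxB hyB hne)
  by_cases hex : ∃ A ∈ G.inscribedCliques, ∃ B ∈ G.inscribedCliques, A ≠ B
  · obtain ⟨A, hA, B, hB, hAB⟩ := hex
    obtain ⟨ξ, hξA, hξB⟩ := hmeet A hA B hB
    -- A third clique `C` missing `ξ` would meet `A` and `B` in distinct vertices, both adjacent to
    -- `ξ`; diamond-freeness then forces `ξ` into `C`.
    have hall : ∀ C ∈ G.inscribedCliques, ξ ∈ C := by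
      intro C hC
      by_cases hCA : C = A
      · rwa [hCA]
      by_cases hCB : C = B
      · rwa [hCB]
      obtain ⟨x, hxC, hxA⟩ := hmeet C hC A hA
      obtain ⟨y, hyC, hyB⟩ := hmeet C hC B hB
      by_cases hxξ : x = ξ
      · rwa [← hxξ]
      by_cases hyξ : y = ξ
      · rwa [← hyξ]
      have hxy : x ≠ y := by
        rintro rfl
        exact hxξ (huniq A hA B hB hAB _ _ hxA hyB hξA hξB)
      exact hC.1.mem_of_adj hG hxC hyC hxy (hA.1.adj hξA hxA (Ne.symm hxξ))
        (hB.1.adj hξB hyB (Ne.symm hyξ))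
    refine ⟨ξ, fun C hC D hD hCD => Set.eq_singleton_iff_unique_mem.2
      ⟨⟨hall C hC, hall D hD⟩, fun x hx => ?_⟩⟩
    exact huniq C hC D hD hCD _ _ hx.1 hx.2 (hall C hC) (hall D hD)
  · exact ⟨f 0, fun A hA B hB hAB => absurd ⟨A, hA, B, hB, hAB⟩ hex⟩

/-- For the pair condition, close the path through `ξ`: on its vertices and `ξ`, both cliques become
rim edges at `ξ`, so the path length is even. -/
theorem hasPathParity (h : G.IsMinimalOddRim Set.univ) (hG : G.IsDiamondFree) :
    G.HasPathParity := by
  obtain ⟨ξ, hξ⟩ := h.exists_common hG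
  refine ⟨fun A hA => h.hasOddGaps hG hA, fun A hA B hB hAB f k hp h0A h0B hkB hkA hin => ?_,
    ξ, hξ⟩
  have hξAB := (Set.eq_singleton_iff_unique_mem.1 (hξ A hA B hB hAB)).1
  have hξA : ξ ∈ A := hξAB.1
  have hξB : ξ ∈ B := hξAB.2
  set T := insert ξ (f '' Set.Iic k)
  have hm : ∀ i ≤ k, f i ∈ T := fun i hi => Or.inr ⟨i, hi, rfl⟩
  have hTA : ∀ w ∈ T, w ∈ A → w = f 0 ∨ w = ξ := by
    rintro _ (rfl | ⟨i, hi, rfl⟩) hw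
    · exact Or.inr rfl
    · left
      rw [Set.mem_Iic] at hi
      rcases Nat.eq_zero_or_pos i with rfl | hpos
      · rfl
      rcases hi.eq_or_lt with rfl | hlt
      · exact absurd hw hkA
      · exact absurd hw (hin i hpos hlt).1
  have hTB : ∀ w ∈ T, w ∈ B → w = f k ∨ w = ξ := by
    rintro _ (rfl | ⟨i, hi, rfl⟩) hw
    · exact Or.inr rfl
    · left
      rw [Set.mem_Iic] at hi
      rcases hi.eq_or_lt with rfl | hlt
      · rfl
      rcases Nat.eq_zero_or_pos i with rfl | hpos
      · exact absurd hw h0B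
      · exact absurd hw (hin i hpos hlt).2
  obtain ⟨c, hc⟩ := h.exists_coloring
    (three_le_card_of_mem_inscribedCliques h.exists_rim_adj hA) hTA
  have e1 := hc _ _ (hA.1.rimOn_adj hG (hm 0 (by omega)) (Or.inl rfl) h0A hξA
    (fun he => h0B (he ▸ hξB)) hTA)
  have e2 := hc _ _ (hB.1.rimOn_adj hG (hm k le_rfl) (Or.inl rfl) hkB hξB
    (fun he => hkA (he ▸ hξA)) hTB)
  rw [← hp.color_eq_iff hm hc]
  revert e1 e2
  generalize c (f 0) = p
  generalize c (f k) = q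
  generalize c ξ = r
  revert p q r
  decide

end IsMinimalOddRim

theorem HasPathParity.nConditions_removeCliques [Finite V] {G : SimpleGraph V}
    (h : G.HasPathParity) (hM : G.IsMultisun) {R : Set (Finset V)} (hR : R ⊆ G.inscribedCliques) :
    (G.removeCliques R).NConditions := by
  have hrim := hM.exists_rim_adj
  obtain ⟨n, f, hf, hrange⟩ := hM.exists_cycle
  have hr := rim_removeCliques hM.1 hrim hR
  have hi := inscribedCliques_removeCliques hM.1 hrim hR
  set H := G.removeCliques R
  have hsub : ∀ {K}, K ∈ H.inscribedCliques → K ∈ G.inscribedCliques := fun hK => by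
    rw [hi] at hK
    exact hK.1
  -- Only membership of the last vertex in `A` matters, so this covers both `A`-paths and
  -- `Aξ`-paths, as `ξ` lies in `A` whenever `B` differs from `A`.
  have h1 : ∀ A ∈ H.inscribedCliques, ∀ (B : Finset V) (u v : V) (p : H.rim.Walk u v),
      H.IsCliquePath A B p → v ∈ A → Even p.support.length := by
    intro A hA B u v p hp hvA
    obtain ⟨g, k, hg, hk, hlen, rfl, rfl, hin⟩ := hp.exists_isRimPath hr
    rw [hlen, Nat.even_add_one, Nat.not_even_iff_odd]
    exact h.single A (hsub hA) g k hg hk hp.2.2.1 hvA fun i h0 hik => hin i h0 hik A hA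
  obtain ⟨ξ, hξ⟩ := h.common
  refine ⟨fun A hA u v p hp => ⟨h1 A hA A u v p hp hp.2.2.2.1, ?_⟩, fun A hA => ?_, ⟨ξ, ?_, ?_⟩, ?_⟩
  · have heven := h1 A hA A u v p hp hp.2.2.2.1
    obtain ⟨g, k, hg, hk, hlen, rfl, rfl, -⟩ := hp.exists_isRimPath hr
    have hk1 : k ≠ 1 := by
      rintro rfl
      exact G.not_rim_adj_of_mem_inscribedCliques (hsub hA) hp.2.2.1 hp.2.2.2.1
        (hg.1 0 (by omega))
    rw [hlen] at heven ⊢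
    obtain ⟨j, hj⟩ := heven
    omega
  · exact hf.odd_card hrange (h.single A (hsub hA))
      (three_le_card_of_mem_inscribedCliques hrim (hsub hA))
  · exact fun A hA B hB hAB => hξ A (hsub hA) B (hsub hB) hAB
  · intro A hA B hB u p hp
    refine h1 A hA B u ξ p hp ?_
    by_cases hAB : A = B
    · rw [hAB]
      exact hp.2.2.2.1
    · exact (Set.eq_singleton_iff_unique_mem.1 (hξ A (hsub hA) B (hsub hB) hAB)).1.1
  · intro A hA B hB hAB u v p hp hu hv
    obtain ⟨g, k, hg, hk, hlen, rfl, rfl, hin⟩ := hp.exists_isRimPath hr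
    rw [hlen, Nat.odd_add_one, Nat.not_odd_iff_even]
    exact h.pair A (hsub hA) B (hsub hB) hAB g k hg hp.2.2.1 (fun hc => hAB (hu B hB hc).symm)
      hp.2.2.2.1 (fun hc => hAB (hv A hA hc))
      fun i h0 hik => ⟨hin i h0 hik A hA, hin i h0 hik B hB⟩

theorem HasPathParity.isSunoid [Finite V] {G : SimpleGraph V} (h : G.HasPathParity)
    (hM : G.IsMultisun) (hne : G.inscribedCliques.Nonempty) : G.IsSunoid := by
  refine ⟨hM, hne, ?_, ?_⟩
  · have := h.nConditions_removeCliques hM (Set.empty_subset _)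
    rwa [removeCliques_empty] at this
  · rintro _ ⟨R, hR, rfl⟩
    exact h.nConditions_removeCliques hM hR.1

/-- Without inscribed cliques every edge is a rim edge and the graph is an odd cycle. It is not a
triangle, whose edges are not maximal cliques. -/
theorem IsMinimalOddRim.isOddHole_or_isSunoid [Finite V] {G : SimpleGraph V}
    (h : G.IsMinimalOddRim Set.univ) (hG : G.IsDiamondFree) : G.IsOddHole ∨ G.IsSunoid := by
  obtain ⟨n, f, hf, hrange⟩ := h.exists_cycle_univ
  by_cases hne : G.inscribedCliques.Nonempty
  · exact Or.inr ((h.hasPathParity hG).isSunoid (hf.isMultisun hG hrange) hne)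
  · left
    have hGr : G.rim = G := by
      classical
      ext u v
      refine ⟨fun h => (rim_adj_iff.1 h).1, fun huv => ?_⟩
      obtain ⟨K, hK, hu, hv⟩ := exists_isMaxClique_of_adj huv
      by_contra hnot
      rw [rim_adj_iff, not_and] at hnot
      have := hnot huv
      push Not at this
      obtain ⟨w, hwu, hwv⟩ := this
      refine hne ⟨K, hK, fun h2 => ?_⟩
      have hw := hK.mem_of_adj hG hu hv huv.ne hwu hwv
      obtain ⟨a, b, -, rfl⟩ := Finset.card_eq_two.1 h2
      simp only [Finset.mem_insert, Finset.mem_singleton] at hu hv hw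
      have := hwu.ne
      have := hwv.ne
      have := huv.ne
      rcases hu with rfl | rfl <;> rcases hv with rfl | rfl <;> rcases hw with rfl | rfl <;>
        contradiction
    have hn3 := hf.three_le
    have hn : n ≠ 3 := by
      rintro rfl
      have h1 := hf.adj 0
      have h2 := hf.adj 1
      have h3 := hf.adj 2
      have h4 := hf.periodic 0
      rw [zero_add] at h4
      rw [h4] at h3
      refine (rim_adj_iff.1 h1).2 (f 2) ⟨?_, ?_⟩
      · exact (rim_adj_iff.1 h3).1
      · exact (rim_adj_iff.1 h2).1.symm
    obtain ⟨e⟩ := hf.nonempty_iso hrange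
    rw [hGr] at e
    obtain ⟨j, hj⟩ := hf.odd
    exact ⟨n, by omega, hf.odd, ⟨e⟩⟩

end SimpleGraph

namespace SimpleGraph

variable {V : Type*} {G : SimpleGraph V}

/-! ### Path parities make the rim minimal -/

/-- Between two cliques through `f 0`, the one met first along the rim encloses the other: before
each of its vertices there is an odd number of vertices of the other one, and before each vertex
of the other one there is an even number of its vertices. -/
theorem HasPathParity.count_parity [DecidableEq V] (h : G.HasPathParity) {n : ℕ} {f : ℕ → V}
    (hf : G.rim.IsInducedOddCycle n f) {X Y : Finset V} (hX : X ∈ G.inscribedCliques)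
    (hY : Y ∈ G.inscribedCliques) (hXY : (X : Set V) ∩ Y = {f 0}) (hne : X ≠ Y) {x : ℕ} (hx0 : 0 < x)
    (hx : f x ∈ X) (hfirst : ∀ i, 0 < i → i ≤ x → f i ∉ Y) {p : ℕ} (hp0 : 0 < p) (hpn : p < n) :
    (f p ∈ Y → Even (Nat.count (fun i => f i ∈ X) p)) ∧
      (f p ∈ X → Odd (Nat.count (fun i => f i ∈ Y) p)) := by
  have h0 := (Set.eq_singleton_iff_unique_mem.1 hXY).1
  have hdisj : ∀ i, 0 < i → i < n → f i ∈ X → f i ∈ Y → False := by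
    intro i h1 h2 hiX hiY
    have := hf.inj_of_lt ((Set.eq_singleton_iff_unique_mem.1 hXY).2 _ ⟨hiX, hiY⟩) (by omega)
      (by omega)
    omega
  have hlast : ∀ {q p : ℕ}, q < p →
      (∀ i, q < i → i < p → ¬ (f i ∈ X ∨ f i ∈ Y)) → ∀ {Z : Finset V}, (Z = X ∨ Z = Y) →
      Nat.count (fun i => f i ∈ Z) p = Nat.count (fun i => f i ∈ Z) q + if f q ∈ Z then 1 else 0 := by
    intro q p hqp hno Z hZ
    rw [← Nat.count_succ]
    refine count_eq_of_forall_not (by omega) fun i h1 h2 h3 => hno i (by omega) h2 ?_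
    rcases hZ with rfl | rfl
    · exact Or.inl h3
    · exact Or.inr h3
  -- At a vertex of `X` or of `Y`, the position has the parity of the number of earlier vertices of
  -- that clique. This turns the even steps of `h.pair` into statements about counts.
  have heX : ∀ {q}, q < n → f q ∈ X → Even (Nat.count (fun i => f i ∈ X) q + q) :=
    fun hq hqX => hf.even_count_add (h.single X hX) h0.1 hq hqX
  have heY : ∀ {q}, q < n → f q ∈ Y → Even (Nat.count (fun i => f i ∈ Y) q + q) :=
    fun hq hqY => hf.even_count_add (h.single Y hY) h0.2 hq hqY
  induction p using Nat.strong_induction_on with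
  | _ p ih =>
    constructor
    · intro hpY
      have hxp : x < p := by
        by_contra hc
        exact hfirst p hp0 (by omega) hpY
      obtain ⟨q, hxq, hqp, hq, hno⟩ := exists_last (P := fun i => f i ∈ X ∨ f i ∈ Y) hxp (Or.inl hx)
      have ihq := ih q hqp (by omega) (by omega)
      rw [hlast hqp hno (Or.inl rfl)]
      rcases hq with hqX | hqY
      · have hqY : f q ∉ Y := fun hc => hdisj q (by omega) (by omega) hqX hc
        have h1 := h.pair X hX Y hY hne (fun i => f (q + i)) (p - q)
          ((hf.shift q).isRimPath (by omega)) hqX hqY (by rwa [show q + (p - q) = p by omega])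
          (by
            rw [show q + (p - q) = p by omega]
            exact fun hc => hdisj p hp0 hpn hc hpY)
          fun i h1 h2 => not_or.1 (hno _ (by omega) (by omega))
        have h2 := heX (by omega) hqX
        have h3 := heY hpn hpY
        rw [hlast hqp hno (Or.inr rfl), if_neg hqY] at h3
        have h4 := ihq.2 hqX
        rw [if_pos hqX]
        grind
      · rw [if_neg fun hc => hdisj q (by omega) (by omega) hc hqY]
        exact ihq.1 hqY
    · intro hpX
      by_cases hxp : x < p
      · obtain ⟨q, hxq, hqp, hq, hno⟩ :=
          exists_last (P := fun i => f i ∈ X ∨ f i ∈ Y) hxp (Or.inl hx)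
        have ihq := ih q hqp (by omega) (by omega)
        rw [hlast hqp hno (Or.inr rfl)]
        rcases hq with hqX | hqY
        · rw [if_neg fun hc => hdisj q (by omega) (by omega) hqX hc]
          exact ihq.2 hqX
        · have hqX : f q ∉ X := fun hc => hdisj q (by omega) (by omega) hc hqY
          have h1 := h.pair Y hY X hX hne.symm (fun i => f (q + i)) (p - q)
            ((hf.shift q).isRimPath (by omega)) hqY hqX
            (by rwa [show q + (p - q) = p by omega])
            (by
              rw [show q + (p - q) = p by omega]
              exact fun hc => hdisj p hp0 hpn hpX hc)
            fun i h1 h2 => (not_or.1 (hno _ (by omega) (by omega))).symm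
          have h2 := heY (by omega) hqY
          have h3 := heX hpn hpX
          rw [hlast hqp hno (Or.inl rfl), if_neg hqX] at h3
          have h4 := ihq.1 hqY
          rw [if_pos hqY]
          grind
      -- Up to position `x`, the only vertex of `Y` met is `f 0`.
      · rw [count_eq_of_forall_not (q := 1) (by omega) fun i h1 h2 => hfirst i (by omega) (by omega),
          Nat.count_succ, if_pos (Finset.mem_coe.1 h0.2)]
        simp

/-- If the cliques `A`, `B`, `C` are met in this order along the rim, then every rim path from `A`
to `C` passes through `B` or the common vertex. -/
theorem HasPathParity.not_exists_rimPath (h : G.HasPathParity) {n : ℕ} {f : ℕ → V}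
    (hf : G.rim.IsInducedOddCycle n f) (hrange : Set.range f = Set.univ) {A B C : Finset V}
    (hA : A ∈ G.inscribedCliques) (hB : B ∈ G.inscribedCliques) (hC : C ∈ G.inscribedCliques)
    (hAB : (A : Set V) ∩ B = {f 0}) (hBC : (B : Set V) ∩ C = {f 0}) (hABne : A ≠ B) (hBCne : B ≠ C)
    {a b : ℕ} (ha0 : 0 < a) (hb0 : 0 < b) (ha : f a ∈ A) (hb : f b ∈ B)
    (haB : ∀ i, 0 < i → i ≤ a → f i ∉ B) (hbC : ∀ i, 0 < i → i ≤ b → f i ∉ C)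
    {g : ℕ → V} {k : ℕ} (hg : ∀ i < k, G.rim.Adj (g i) (g (i + 1)))
    (hgB : ∀ i ≤ k, g i ∉ B) (hgξ : ∀ i ≤ k, g i ≠ f 0)
    (hends : g 0 ∈ A ∧ g k ∈ C ∨ g 0 ∈ C ∧ g k ∈ A) : False := by
  classical
  choose π hπ0 hπn hπ using hf.exists_index hrange 0
  have hpos : ∀ i ≤ k, 0 < π (g i) ∧ π (g i) < n := by
    intro i hi
    refine ⟨Nat.pos_of_ne_zero fun h0 => hgξ i hi ?_, by have := hπn (g i); omega⟩
    rw [← h0, hπ]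
  -- Avoiding `f 0`, the path cannot wrap around the rim; avoiding `B`, it never changes the number
  -- of earlier vertices of `B`. That number is odd at vertices of `A` and even at vertices of `C`.
  have hconst : ∀ i ≤ k, Nat.count (fun i => f i ∈ B) (π (g i)) =
      Nat.count (fun i => f i ∈ B) (π (g 0)) := by
    intro i hi
    induction i with
    | zero => rfl
    | succ i ih =>
      rw [← ih (by omega)]
      have hadj := hg i (by omega)
      obtain ⟨h1, h2⟩ := hpos i (by omega)
      obtain ⟨h3, h4⟩ := hpos (i + 1) hi
      have hmod : ∀ {u v : ℕ}, 0 < u → u < n → 0 < v → v < n → v ≡ u + 1 [MOD n] → v = u + 1 := by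
        intro u v hu0 hu hv0 hv huv
        rw [← hf.eq_iff] at huv
        exact hf.inj_of_lt huv (by omega) (by omega)
      rw [← hπ (g i), ← hπ (g (i + 1)), hf.adj_iff] at hadj
      rcases hadj with hadj | hadj
      · rw [hmod h1 h2 h3 h4 hadj, Nat.count_succ, if_neg, add_zero]
        rw [hπ]
        exact hgB i (by omega)
      · rw [hmod h3 h4 h1 h2 hadj, Nat.count_succ, if_neg, add_zero]
        rw [hπ]
        exact hgB (i + 1) hi
  have key : ∀ {i j}, i ≤ k → j ≤ k → g i ∈ A → g j ∈ C → False := by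
    intro i j hi hj hiA hjC
    have h1 := (h.count_parity hf hA hB hAB hABne ha0 ha haB (hpos i hi).1 (hpos i hi).2).2
      (by rwa [hπ])
    have h2 := (h.count_parity hf hB hC hBC hBCne hb0 hb hbC (hpos j hj).1 (hpos j hj).2).1
      (by rwa [hπ])
    rw [hconst i hi] at h1
    rw [hconst j hj] at h2
    exact (Nat.not_even_iff_odd.2 h1) h2
  rcases hends with hends | hends
  · exact key (by omega) le_rfl hends.1 hends.2
  · exact key le_rfl (by omega) hends.2 hends.1

/-- An odd rim cycle of an induced subgraph that uses only rim edges spans the whole graph. -/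
theorem IsInducedOddCycle.eq_univ_of_forall_rim_adj {n m : ℕ} {f g : ℕ → V} {T : Set V}
    (hf : G.rim.IsInducedOddCycle n f) (hfr : Set.range f = Set.univ)
    (hg : (G.rimOn T).IsInducedOddCycle m g) (hgr : Set.range g = T)
    (hadj : ∀ j, G.rim.Adj (g j) (g (j + 1))) : T = Set.univ := by
  have hm := hg.three_le
  -- The two neighbours on `g` are distinct rim neighbours, so they are both rim neighbours and one
  -- of them is `f (i + 1)`.
  have hnext : ∀ i, f i ∈ T → f (i + 1) ∈ T := by
    intro i hi
    rw [← hgr] at hi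
    obtain ⟨j, hj⟩ := hi
    obtain ⟨u, hu⟩ := (Set.range_eq_univ.1 hfr) (g (j + 1))
    obtain ⟨v, hv⟩ := (Set.range_eq_univ.1 hfr) (g (j + m - 1))
    have h1 := hadj j
    have h2 := hadj (j + m - 1)
    rw [show j + m - 1 + 1 = j + m by omega, hg.periodic] at h2
    rw [hj, ← hu, hf.adj_iff] at h1
    rw [hj, ← hv, hf.adj_iff] at h2
    rcases h1 with h1 | h1
    · rw [← hf.eq_iff.2 h1, hu, ← hgr]
      exact ⟨_, rfl⟩
    rcases h2 with h2 | h2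
    · have h3 : g (j + 1) = g (j + m - 1) := by
        rw [← hu, ← hv, hf.eq_iff]
        exact Nat.ModEq.add_right_cancel' 1 (h1.symm.trans h2)
      have := hg.inj_of_lt h3 (by omega) (by omega)
      have := hg.odd
      grind
    · rw [← hf.eq_iff.2 h2, hv, ← hgr]
      exact ⟨_, rfl⟩
  obtain ⟨s, hs⟩ := (Set.range_eq_univ.1 hfr) (g 0)
  have hall : ∀ i, f (s + i) ∈ T := by
    intro i
    induction i with
    | zero =>
      rw [add_zero, hs, ← hgr]
      exact ⟨0, rfl⟩
    | succ i ih => exact hnext _ ih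
  refine Set.eq_univ_of_forall fun v => ?_
  obtain ⟨i, rfl⟩ := (Set.range_eq_univ.1 (hf.range_shift hfr s)) v
  exact hall i

/-! ### Chords of odd rim cycles of induced subgraphs -/

/-- `g` runs through an odd rim cycle of the subgraph induced by `T`, and `A j` is the maximal
clique that contains its `j`-th edge. -/
structure IsCliqueCycle (G : SimpleGraph V) (T : Set V) (m : ℕ) (g : ℕ → V)
    (A : ℕ → Finset V) : Prop where
  cycle : (G.rimOn T).IsInducedOddCycle m g
  range : Set.range g = T
  isMaxClique : ∀ j, G.IsMaxClique (A j)
  left : ∀ j, g j ∈ A j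
  right : ∀ j, g (j + 1) ∈ A j

/-- The `j`-th edge of the cycle is not a rim edge of the whole graph. -/
def IsChord (G : SimpleGraph V) (g : ℕ → V) (j : ℕ) : Prop := ¬ G.rim.Adj (g j) (g (j + 1))

theorem rim_adj_of_not_isChord {g : ℕ → V} {a b : ℕ}
    (hno : ∀ i, a ≤ i → i < b → ¬ G.IsChord g i) :
    ∀ i < b - a, G.rim.Adj (g (a + i)) (g (a + (i + 1))) := fun i hi =>
  not_not.1 (hno (a + i) (by omega) (by omega))

namespace IsCliqueCycle

variable {T : Set V} {m : ℕ} {g : ℕ → V} {A : ℕ → Finset V}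

theorem eq_or_eq (hc : G.IsCliqueCycle T m g A) {j : ℕ} {w : V} (hw : w ∈ T) (hwA : w ∈ A j) :
    w = g j ∨ w = g (j + 1) := by
  by_contra hcon
  rw [not_or] at hcon
  exact (hc.cycle.adj j).2.2.2 w hw ⟨(hc.isMaxClique j).adj hwA (hc.left j) hcon.1,
    (hc.isMaxClique j).adj hwA (hc.right j) hcon.2⟩

theorem mem_range (hc : G.IsCliqueCycle T m g A) (i : ℕ) : g i ∈ T := hc.range ▸ ⟨i, rfl⟩

theorem notMem_of_lt (hc : G.IsCliqueCycle T m g A) {i j : ℕ} (h1 : j + 2 ≤ i) (h2 : i < j + m) :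
    g i ∉ A j := by
  intro hmem
  rcases hc.eq_or_eq (hc.mem_range i) hmem with h | h
  · have := hc.cycle.inj_of_lt h (by omega) (by omega)
    omega
  · have := hc.cycle.inj_of_lt h (by omega) (by omega)
    omega

theorem notMem_of_gt (hc : G.IsCliqueCycle T m g A) {i j : ℕ} (h1 : i < j) (h2 : j + 1 < i + m) :
    g i ∉ A j := by
  rw [← hc.cycle.periodic]
  exact hc.notMem_of_lt (by omega) (by omega)

theorem clique_ne (hc : G.IsCliqueCycle T m g A) {i j : ℕ} (h1 : i < j) (h2 : j < i + m) :
    A i ≠ A j := by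
  intro he
  have hm := hc.cycle.three_le
  rcases Nat.eq_or_lt_of_le (Nat.succ_le_of_lt h1) with h | h
  · refine hc.notMem_of_lt (i := i + 2) (j := i) (by omega) (by omega) ?_
    rw [he, ← h]
    exact hc.right (i + 1)
  · refine hc.notMem_of_lt (i := j) (j := i) (by omega) (by omega) ?_
    rw [he]
    exact hc.left j

theorem periodic (hc : G.IsCliqueCycle T m g A) (hG : G.IsDiamondFree) (j : ℕ) :
    A (j + m) = A j := by
  refine (hc.isMaxClique _).eq_of_mem (hc.isMaxClique j) hG (u := g j) (v := g (j + 1)) ?_ ?_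
    (hc.left j) (hc.right j) (hc.cycle.adj j).ne
  · have := hc.left (j + m)
    rwa [hc.cycle.periodic] at this
  · have := hc.right (j + m)
    rwa [show j + m + 1 = j + 1 + m by omega, hc.cycle.periodic] at this

theorem isChord_congr (hc : G.IsCliqueCycle T m g A) {i j : ℕ} (h : i ≡ j [MOD m]) :
    G.IsChord g i ↔ G.IsChord g j := by
  unfold IsChord
  rw [hc.cycle.eq_iff.2 h, hc.cycle.eq_iff.2 (h.add_right 1)]

theorem isChord_add (hc : G.IsCliqueCycle T m g A) {j : ℕ} :
    G.IsChord g (j + m) ↔ G.IsChord g j := hc.isChord_congr (by simp [Nat.ModEq])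

theorem mem_inscribedCliques (hc : G.IsCliqueCycle T m g A) {j : ℕ} (hj : G.IsChord g j) :
    A j ∈ G.inscribedCliques := by
  refine ⟨hc.isMaxClique j, fun h2 => hj ⟨(hc.cycle.adj j).ne, A j, hc.isMaxClique j, ?_⟩⟩
  refine (Set.eq_of_subset_of_ncard_le ?_ ?_ (A j).finite_toSet).symm
  · rintro _ (rfl | rfl)
    · exact hc.left j
    · exact hc.right j
  · rw [Set.ncard_coe_finset, h2, Set.ncard_pair (hc.cycle.adj j).ne]

theorem isRimPath (hc : G.IsCliqueCycle T m g A) {a b : ℕ} (hb : b < a + m)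
    (hno : ∀ i, a ≤ i → i < b → ¬ G.IsChord g i) : G.IsRimPath (fun i => g (a + i)) (b - a) :=
  ⟨rim_adj_of_not_isChord hno, fun i j hi hj hij => by
    have := hc.cycle.pos
    have := hc.cycle.inj_of_lt hij (by omega) (by omega)
    omega⟩

/-- There is more than one chord. -/
theorem chord_lt (hc : G.IsCliqueCycle T m g A) (h : G.HasPathParity) {j j' : ℕ}
    (hj : G.IsChord g j) (hno : ∀ i, j < i → i < j' → ¬ G.IsChord g i) :
    j' < j + m := by
  have hm := hc.cycle.three_le
  by_contra hle
  -- With a single chord, the rest of the cycle is a rim path between two vertices of `A j`, of even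
  -- length `m - 1`.
  have h1 := h.single (A j) (hc.mem_inscribedCliques hj) (fun i => g (j + 1 + i)) (j + m - (j + 1))
    (hc.isRimPath (by omega) fun i h1 h2 => hno i (by omega) (by omega)) (by omega)
    (hc.right j) (by
      rw [show j + 1 + (j + m - (j + 1)) = j + m by omega, hc.cycle.periodic]
      exact hc.left j)
    fun i h1 h2 => hc.notMem_of_lt (by omega) (by omega)
  have := hc.cycle.odd
  grind

/-- The arc between consecutive chords is a rim path joining their cliques. The two extra hypotheses
exclude ends in the intersection of the cliques. -/
theorem even_sub (hc : G.IsCliqueCycle T m g A) (h : G.HasPathParity) {j j' : ℕ}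
    (hj : G.IsChord g j) (hj' : G.IsChord g j') (hjj' : j < j') (hlt : j' < j + m)
    (hno : ∀ i, j < i → i < j' → ¬ G.IsChord g i) (h1 : g (j + 1) ∉ A j') (h2 : g j' ∉ A j) :
    Even (j' - (j + 1)) := by
  have e : j + 1 + (j' - (j + 1)) = j' := by omega
  exact h.pair (A j) (hc.mem_inscribedCliques hj) (A j') (hc.mem_inscribedCliques hj')
    (hc.clique_ne hjj' hlt) (fun i => g (j + 1 + i)) (j' - (j + 1))
    (hc.isRimPath (by omega) fun i h1 h2 => hno i (by omega) h2) (hc.right j) h1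
    (by rw [e]; exact hc.left j') (by rwa [e])
    fun i h1 h2 => ⟨hc.notMem_of_lt (by omega) (by omega), hc.notMem_of_gt (by omega) (by omega)⟩

/-- The common vertex of the inscribed cliques is not on the cycle. -/
theorem common_notMem (hc : G.IsCliqueCycle T m g A) (h : G.HasPathParity) {ξ : V}
    (hξ : ∀ A ∈ G.inscribedCliques, ∀ B ∈ G.inscribedCliques, A ≠ B → (A : Set V) ∩ B = {ξ})
    {j : ℕ} (hj : G.IsChord g j) : ξ ∉ T := by
  intro hξT
  have hm := hc.cycle.three_le
  obtain ⟨j', hjj', -, hj', hno⟩ := exists_next (P := G.IsChord g) (show j < j + m by omega)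
    (hc.isChord_add.2 hj)
  have hlt := hc.chord_lt h hj hno
  have hne := hc.clique_ne hjj' hlt
  have hcommon : ∀ i, G.IsChord g i → ξ ∈ A i := by
    intro i hi
    by_cases hij : A i = A j
    · exact (Set.eq_singleton_iff_unique_mem.1 (hξ _ (hc.mem_inscribedCliques hi) _
        (hc.mem_inscribedCliques hj') (hij ▸ hne))).1.1
    · exact (Set.eq_singleton_iff_unique_mem.1 (hξ _ (hc.mem_inscribedCliques hi) _
        (hc.mem_inscribedCliques hj) hij)).1.1
  obtain ⟨s, hs⟩ : ∃ s, g (s + 1) = ξ := by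
    rw [← hc.range] at hξT
    obtain ⟨t, rfl⟩ := hξT
    exact ⟨t + m - 1, by rw [show t + m - 1 + 1 = t + m by omega, hc.cycle.periodic]⟩
  -- The clique of every chord contains `ξ` but has only two vertices on the cycle, so only the two
  -- edges at `ξ` can be chords, and both are.
  have hmod : ∀ i, G.IsChord g i → s + 1 ≡ i [MOD m] ∨ s + 1 ≡ i + 1 [MOD m] := by
    intro i hi
    rcases hc.eq_or_eq hξT (hcommon i hi) with h | h
    · exact Or.inl (hc.cycle.inj _ _ (hs.trans h))
    · exact Or.inr (hc.cycle.inj _ _ (hs.trans h))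
  have hneq : ¬ j ≡ j' [MOD m] := fun hcon => by
    have := hc.cycle.inj_of_lt (hc.cycle.eq_iff.2 hcon) (by omega) (by omega)
    omega
  have hboth : G.IsChord g s ∧ G.IsChord g (s + 1) := by
    rcases hmod j hj with h1 | h1 <;> rcases hmod j' hj' with h2 | h2
    · exact absurd (h1.symm.trans h2) hneq
    · exact ⟨(hc.isChord_congr (Nat.ModEq.add_right_cancel' 1 h2)).2 hj',
        (hc.isChord_congr h1).2 hj⟩
    · exact ⟨(hc.isChord_congr (Nat.ModEq.add_right_cancel' 1 h1)).2 hj,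
        (hc.isChord_congr h2).2 hj'⟩
    · exact absurd (Nat.ModEq.add_right_cancel' 1 (h1.symm.trans h2)) hneq
  -- The remaining arc has length `m - 2`, which is odd.
  have heven := hc.even_sub h hboth.2 (hc.isChord_add.2 hboth.1) (by omega) (by omega)
    (fun i h1 h2 hi => by
      rcases hmod i hi with h3 | h3
      · have := hc.cycle.inj_of_lt (hc.cycle.eq_iff.2 h3) (by omega) (by omega)
        omega
      · have := hc.cycle.inj_of_lt (hc.cycle.eq_iff.2 h3) (by omega) (by omega)
        omega)
    (hc.notMem_of_gt (by omega) (by omega)) (hc.notMem_of_lt (by omega) (by omega))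
  have := hc.cycle.odd
  grind

/-- Consider the chord whose clique is first met after `ξ` on the rim, and the preceding and
following chords, whose cliques are distinct. Of these two, the clique met later is joined to the
first by an arc of the cycle that avoids the other and `ξ`, against
`HasPathParity.not_exists_rimPath`. -/
theorem not_isChord (hc : G.IsCliqueCycle T m g A) (h : G.HasPathParity) (hG : G.IsDiamondFree)
    {n : ℕ} {f : ℕ → V} (hf : G.rim.IsInducedOddCycle n f) (hfr : Set.range f = Set.univ) (j : ℕ) :
    ¬ G.IsChord g j := by
  intro hj
  have hm := hc.cycle.three_le
  have hn := hf.three_le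
  obtain ⟨ξ, hξ⟩ := h.common
  have hξT := hc.common_notMem h hξ hj
  have hodd : ∀ {j j'}, G.IsChord g j → G.IsChord g j' → j < j' →
      (∀ i, j < i → i < j' → ¬ G.IsChord g i) → j' < j + m ∧ Odd (j' - j) := by
    intro j j' hj hj' hjj' hno
    have hlt := hc.chord_lt h hj hno
    have hAA := Set.eq_singleton_iff_unique_mem.1 (hξ _ (hc.mem_inscribedCliques hj) _
      (hc.mem_inscribedCliques hj') (hc.clique_ne hjj' hlt))
    have := hc.even_sub h hj hj' hjj' hlt hno
      (fun hmem => hξT (hAA.2 _ ⟨hc.right j, hmem⟩ ▸ hc.mem_range _))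
      (fun hmem => hξT (hAA.2 _ ⟨hmem, hc.left j'⟩ ▸ hc.mem_range _))
    exact ⟨hlt, by grind⟩
  obtain ⟨r, hr⟩ := (Set.range_eq_univ.1 hfr) ξ
  have hf₀ := hf.shift r
  have hfr₀ := hf.range_shift hfr r
  set f₀ := fun i => f (r + i)
  have hf00 : f₀ 0 = ξ := hr
  have hmeet : ∀ i, G.IsChord g i → ∃ p, 0 < p ∧ f₀ p ∈ A i := by
    intro i hi
    obtain ⟨p, -, -, hp⟩ := hf₀.exists_index hfr₀ 0 (g i)
    refine ⟨p, Nat.pos_of_ne_zero ?_, hp ▸ hc.left i⟩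
    rintro rfl
    exact hξT (hf00 ▸ hp ▸ hc.mem_range i)
  -- Position `0` is excluded because `f₀ 0 = ξ`. For chords the infimum is attained by `hmeet`.
  let first : ℕ → ℕ := fun i => sInf {p | 0 < p ∧ f₀ p ∈ A i}
  have hfirst : ∀ i, G.IsChord g i → 0 < first i ∧ f₀ (first i) ∈ A i := fun i hi =>
    Nat.sInf_mem (s := {p | 0 < p ∧ f₀ p ∈ A i}) (hmeet i hi)
  have hfirst_le : ∀ i p, 0 < p → f₀ p ∈ A i → first i ≤ p := fun i p h1 h2 =>
    Nat.sInf_le ⟨h1, h2⟩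
  have hfirst_lt : ∀ i, G.IsChord g i → first i < n := by
    intro i hi
    obtain ⟨p, -, hpn, hp⟩ := hf₀.exists_index hfr₀ 0 (g i)
    refine lt_of_le_of_lt (hfirst_le i p (Nat.pos_of_ne_zero ?_) (hp ▸ hc.left i)) (by omega)
    rintro rfl
    exact hξT (hf00 ▸ hp ▸ hc.mem_range i)
  have hfirst_ne : ∀ i i', G.IsChord g i → G.IsChord g i' → A i ≠ A i' → first i ≠ first i' := by
    intro i i' hi hi' hne he
    have h1 := hfirst i hi
    have h2 := hfirst i' hi'
    rw [← he] at h2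
    have h3 := (Set.eq_singleton_iff_unique_mem.1 (hξ _ (hc.mem_inscribedCliques hi) _
      (hc.mem_inscribedCliques hi') hne)).2 _ ⟨h1.2, h2.2⟩
    have := hf₀.inj_of_lt (h3.trans hf00.symm) (by have := hfirst_lt i hi; omega) (by omega)
    omega
  -- the clique that is met first, and its neighbours on the cycle
  obtain ⟨J, hJ, hJmin⟩ : ∃ J, G.IsChord g J ∧ ∀ i, G.IsChord g i → first J ≤ first i := by
    classical
    have hex : ∃ v, ∃ i, G.IsChord g i ∧ first i = v := ⟨_, j, hj, rfl⟩
    obtain ⟨J, hJ, hJv⟩ := Nat.find_spec hex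
    exact ⟨J, hJ, fun i hi => hJv ▸ Nat.find_min' hex ⟨i, hi, rfl⟩⟩
  have hfirst_add : ∀ i, first (i + m) = first i := fun i => by
    simp only [first, hc.periodic hG]
  -- The index `J + m` instead of `J` leaves room for the preceding chord without truncated
  -- subtraction.
  have hK := hc.isChord_add.2 hJ
  have hKmin : ∀ i, G.IsChord g i → first (J + m) ≤ first i := by
    rw [hfirst_add]
    exact hJmin
  obtain ⟨a, hJa, haK, ha, hano⟩ := exists_last (P := G.IsChord g) (show J < J + m by omega) hJ
  obtain ⟨b, hKb, hbK, hb, hbno⟩ := exists_next (P := G.IsChord g)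
    (show J + m < J + m + m by omega) (hc.isChord_add.2 hK)
  obtain ⟨haK', hodd1⟩ := hodd ha hK haK hano
  obtain ⟨hbK', hodd2⟩ := hodd hK hb hKb hbno
  have hba : b ≤ a + m := by
    by_contra hcon
    exact hbno (a + m) (by omega) (by omega) (hc.isChord_add.2 ha)
  -- With just two chords, `m` would be the sum of two odd distances.
  have hbane : b ≠ a + m := by
    have := hc.cycle.odd
    rintro rfl
    grind
  have hneKa := (hc.clique_ne haK haK').symm
  have hneKb := hc.clique_ne hKb hbK'
  have hneab := hc.clique_ne (show a < b by omega) (show b < a + m by omega)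
  have hinter : ∀ i i', G.IsChord g i → G.IsChord g i' → A i ≠ A i' →
      (A i : Set V) ∩ A i' = {f₀ 0} := fun i i' hi hi' hne => by
    rw [hf00]
    exact hξ _ (hc.mem_inscribedCliques hi) _ (hc.mem_inscribedCliques hi') hne
  have hlt1 := lt_of_le_of_ne (hKmin a ha) (hfirst_ne _ _ hK ha hneKa)
  have hlt2 := lt_of_le_of_ne (hKmin b hb) (hfirst_ne _ _ hK hb hneKb)
  have hbefore : ∀ i i', first i < first i' → ∀ p, 0 < p → p ≤ first i → f₀ p ∉ A i' :=
    fun i i' hii p h1 h2 hp => by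
      have := hfirst_le i' p h1 hp
      omega
  rcases lt_or_gt_of_ne (hfirst_ne a b ha hb hneab) with hlt | hlt
  · exact h.not_exists_rimPath hf₀ hfr₀ (hc.mem_inscribedCliques hK) (hc.mem_inscribedCliques ha)
      (hc.mem_inscribedCliques hb) (hinter _ _ hK ha hneKa) (hinter _ _ ha hb hneab) hneKa hneab
      (hfirst _ hK).1 (hfirst _ ha).1 (hfirst _ hK).2 (hfirst _ ha).2 (hbefore _ _ hlt1)
      (hbefore _ _ hlt)
      (rim_adj_of_not_isChord (a := J + m + 1) (b := b) fun i h1 h2 => hbno i (by omega) h2)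
      (fun i hi => hc.notMem_of_lt (by omega) (by omega))
      (fun i hi he => hξT (hf00 ▸ he ▸ hc.mem_range _))
      (Or.inl ⟨hc.right _, by
        rw [show J + m + 1 + (b - (J + m + 1)) = b by omega]
        exact hc.left b⟩)
  · exact h.not_exists_rimPath hf₀ hfr₀ (hc.mem_inscribedCliques hK) (hc.mem_inscribedCliques hb)
      (hc.mem_inscribedCliques ha) (hinter _ _ hK hb hneKb) (hinter _ _ hb ha hneab.symm) hneKb
      hneab.symm (hfirst _ hK).1 (hfirst _ hb).1 (hfirst _ hK).2 (hfirst _ hb).2 (hbefore _ _ hlt2)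
      (hbefore _ _ hlt)
      (rim_adj_of_not_isChord (a := a + 1) (b := J + m) fun i h1 h2 => hano i (by omega) h2)
      (fun i hi => hc.notMem_of_gt (by omega) (by omega))
      (fun i hi he => hξT (hf00 ▸ he ▸ hc.mem_range _))
      (Or.inr ⟨hc.right _, by
        rw [show a + 1 + (J + m - (a + 1)) = J + m by omega]
        exact hc.left _⟩)

end IsCliqueCycle

/-- A non-bipartite proper subset contains a minimal one, spanned by an odd cycle. Being free of
chords, this cycle is the whole rim. -/
theorem HasPathParity.isMinimalOddRim [Finite V] (h : G.HasPathParity) (hG : G.IsDiamondFree)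
    {n : ℕ} {f : ℕ → V} (hf : G.rim.IsInducedOddCycle n f) (hfr : Set.range f = Set.univ) :
    G.IsMinimalOddRim Set.univ := by
  refine ⟨?_, fun T hT => ?_⟩
  · unfold IsRimBipartite
    rw [rimOn_univ]
    exact hf.not_isTwoColorable
  · by_contra hcon
    obtain ⟨U, hUT, hU⟩ := exists_isMinimalOddRim hcon
    obtain ⟨m, g, hg, hgr⟩ := hU.exists_cycle
    choose A hA hl hr using fun j => exists_isMaxClique_of_adj (hg.adj j).2.2.1
    have hc : G.IsCliqueCycle U m g A := ⟨hg, hgr, hA, hl, hr⟩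
    have := hf.eq_univ_of_forall_rim_adj hfr hg hgr fun j =>
      not_not.1 (hc.not_isChord h hG hf hfr j)
    exact hT.2 (this ▸ hUT)

theorem IsSunoid.isMinimalOddRim [Finite V] (h : G.IsSunoid) : G.IsMinimalOddRim Set.univ := by
  obtain ⟨n, f, hf, hfr⟩ := h.1.exists_cycle
  exact h.hasPathParity.isMinimalOddRim h.1.1 hf hfr

/-- An odd hole has no inscribed cliques, so the path parities hold vacuously. -/
theorem IsOddHole.isMinimalOddRim [Finite V] (h : G.IsOddHole) (hG : G.IsDiamondFree) :
    G.IsMinimalOddRim Set.univ := by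
  obtain ⟨hGr, n, f, hf, hfr⟩ := h.exists_cycle
  have hempty : ∀ A, A ∉ G.inscribedCliques := by
    intro A hA
    obtain ⟨u, hu, v, hv, huv⟩ := Finset.one_lt_card.1 (show 1 < A.card from
      lt_of_lt_of_le (by omega) (three_le_card_of_mem_inscribedCliques
        (fun u => by
          obtain ⟨i, rfl⟩ := (Set.range_eq_univ.1 hfr) u
          exact ⟨_, hf.adj i⟩) hA))
    refine G.not_rim_adj_of_mem_inscribedCliques hA hu hv ?_
    rw [hGr]
    exact hA.1.adj hu hv huv
  exact HasPathParity.isMinimalOddRim ⟨fun A hA => absurd hA (hempty A),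
    fun A hA => absurd hA (hempty A), f 0, fun A hA => absurd hA (hempty A)⟩ hG hf hfr

end SimpleGraph

/-! ### The characterisation and minimality -/

theorem mainTheorem4 {V : Type*} [Finite V] (G : SimpleGraph V) (hG : G.IsDiamondFree) :
    (G.IsCliquePerfect ↔ ∀ s : Set V, ¬ (G.induce s).IsOddHole ∧ ¬ (G.induce s).IsSunoid) ∧
    (G.IsOddHole ∨ G.IsSunoid → G.IsMinimallyCliqueImperfect) := by
  constructor
  · rw [SimpleGraph.isCliquePerfect_iff hG]
    constructor
    · intro h s
      exact ⟨fun hs => (SimpleGraph.isMinimalOddRim_induce.1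
          (hs.isMinimalOddRim (hG.induce s))).1 (h s),
        fun hs => (SimpleGraph.isMinimalOddRim_induce.1 hs.isMinimalOddRim).1 (h s)⟩
    · intro h S
      by_contra hS
      obtain ⟨T, -, hT⟩ := SimpleGraph.exists_isMinimalOddRim hS
      rcases (SimpleGraph.isMinimalOddRim_induce.2 hT).isOddHole_or_isSunoid (hG.induce T) with
        h1 | h1
      · exact (h T).1 h1
      · exact (h T).2 h1
  · rintro (h | h)
    · exact (h.isMinimalOddRim hG).isMinimallyCliqueImperfect hG
    · exact h.isMinimalOddRim.isMinimallyCliqueImperfect hG
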